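/- All graphs are finite, simple and undirected. For a graph $H$ and $S\subseteq V(H)$, let $H[S]$ be the subgraph induced by $S$, and let $\partial_H(S)$ be the set of vertices of $S$ that have a neighbor in $V(H)\setminus S$. A graph is a $k$-matching if it is isomorphic to the graph on $2k$ vertices that consists of $k$ vertex-disjoint edges. For $M\subseteq V(H)$, the pair $(H,M)$ is called a $k$-matching gadget if $H[M]$ is a $k$-matching and, with $C:=V(H)\setminus M$, the following holds: whenever $C'\subseteq V(H)$ and $f$ is an isomorphism from $H[C]$ to $H[C']$ such that (1) $H[V(H)\setminus C']$ has no isolated vertex, (2) $H[V(H)\setminus C']$ is bipartite, and (3) $f(\partial_H(C))=\partial_H(C')$, then $H[V(H)\setminus C']$ is a $k$-matching. Theorem. Let $\mathcal H$ be a class of graphs whose vertex-cover numbers are unbounded (for every $b\in\mathbb N$ some $H\in\mathcal H$ has no vertex cover of size at most $b$) and whose treewidths are bounded (there is $w\in\mathbb N$ such that every $H\in\mathcal H$ has treewidth at most $w$). Then for every $k\in\mathbb N$ there exist a graph $H\in\mathcal H$ and a set $M\subseteq V(H)$ such that $(H,M)$ is a $k$-matching gadget. -/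

import Mathlib

universe u

/-- A finite simple graph, bundled with its vertex type. -/
structure FiniteGraph where
  V : Type u
  [finite : Finite V]
  graph : SimpleGraph V

attribute [instance] FiniteGraph.finite

/-- A graph parameter is bounded on a class of graphs if a single natural number bounds it
on all members of the class. -/
def IsBoundedOn (f : FiniteGraph.{u} → ℕ∞) (𝓗 : Set FiniteGraph.{u}) : Prop :=
  ∃ b : ℕ, ∀ H ∈ 𝓗, f H ≤ b

/-- A tree decomposition of a graph: a finite tree together with a bag for each of its nodes. -/
structure TreeDecomposition {V : Type u} (G : SimpleGraph V) where
  Node : Type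
  [finite : Finite Node]
  tree : SimpleGraph Node
  isTree : tree.IsTree
  bag : Node → Set V
  iUnion_bag : ⋃ t, bag t = Set.univ
  edge_mem : ∀ u v : V, G.Adj u v → ∃ t, u ∈ bag t ∧ v ∈ bag t
  connected : ∀ v : V, (tree.induce {t | v ∈ bag t}).Connected

/-- The maximum size of a bag minus one. (For the graph without vertices the truncated subtraction
gives `0` instead of `-1`, which does not affect boundedness on a class.) -/
noncomputable def TreeDecomposition.width {V : Type u} {G : SimpleGraph V}
    (D : TreeDecomposition G) : ℕ∞ :=
  (⨆ t, (D.bag t).encard) - 1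

/-- The minimum width of a tree decomposition. -/
noncomputable def treewidth {V : Type u} (G : SimpleGraph V) : ℕ∞ :=
  ⨅ D : TreeDecomposition G, D.width

/-- The graph on `2k` vertices that consists of `k` vertex-disjoint edges. -/
def disjointEdges (k : ℕ) : SimpleGraph (Fin k × Bool) where
  Adj x y := x.1 = y.1 ∧ x.2 ≠ y.2
  symm := ⟨fun _ _ h => ⟨h.1.symm, h.2.symm⟩⟩
  loopless := ⟨fun _ h => h.2 rfl⟩

/-- `G` is a `k`-matching: it is isomorphic to `k` vertex-disjoint edges. -/
def IsKMatching {V : Type u} (G : SimpleGraph V) (k : ℕ) : Prop :=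
  Nonempty (G ≃g disjointEdges k)

/-- The set of vertices of `C` that have a neighbor outside `C`. -/
def vertexBoundary {V : Type u} (H : SimpleGraph V) (C : Set V) : Set V :=
  {v | v ∈ C ∧ ∃ w, w ∉ C ∧ H.Adj v w}

/-- The isomorphism `f` from `H[C]` to `H[C']` maps the boundary of `C` onto that of `C'`. -/
def IsBoundaryPreserving {V : Type u} (H : SimpleGraph V) {C C' : Set V}
    (f : H.induce C ≃g H.induce C') : Prop :=
  (fun x : C => (f x : V)) '' {x : C | (x : V) ∈ vertexBoundary H C} = vertexBoundary H C'

/-- `(H, M)` is a `k`-matching gadget. The induced matching is given by its vertex set `M`,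
so that `C = Mᶜ`. -/
def IsMatchingGadget {V : Type u} (H : SimpleGraph V) (k : ℕ) (M : Set V) : Prop :=
  IsKMatching (H.induce M) k ∧
    ∀ (C' : Set V) (f : H.induce Mᶜ ≃g H.induce C'),
      (∀ v, ¬ (H.induce C'ᶜ).IsIsolated v) →
      (H.induce C'ᶜ).IsBipartite →
      IsBoundaryPreserving H f →
      IsKMatching (H.induce C'ᶜ) k

/-!
A boundary preserving isomorphism from `H - M` to `H - D` is called a swap. Let `M` consist of the
endpoints of `k` edges of `H - S` that lie in at most `t` triangles of `H - S` each and whose closed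
neighborhoods in `H - S` are disjoint, and suppose that every swap maps `S` to itself. If no edge in
fewer than `t` triangles (a low edge) has both ends in the closed neighborhood of `M`, then the swap
permutes the low edges, so every edge of `H[D]` lies in at least `t` triangles, whose third vertices
lie outside `D` because `H[D]` is bipartite. A swap preserves the sum of the degrees, and comparing
the edges at `D` with those at `M` leaves room for at most `k` edges inside `D`. Without isolated
vertices, these form a `k`-matching.

Such `S` and `M` are found by induction on `t`, starting from `S = ∅` with `t` so large that, by
bounded treewidth, the low edges have cover number at least half of that of `H`. In each step, the
low edges have large cover number, but only few vertices (the hubs) have a large share of it nearby.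
A swap changes the share of a vertex only slightly when the closed neighborhood of `M` has small
weight, so adding the hubs above a gap in the sequence of shares to `S` keeps `S` invariant under
swaps. Away from the hubs, bounded treewidth yields many disjoint closed neighborhoods of low edges.
If the edges in one triangle less still have large cover number, the induction continues; otherwise
all but a bounded number of the scattered edges avoid a cover of these and have small weight, and
any `k` of them give a gadget.
-/

/-! ### Trees and tree decompositions -/

/-- A rooting of a tree: every edge joins a node to its parent, which is one level higher. -/
structure TreeRooting {N : Type*} (T : SimpleGraph N) where
  depth : N → ℕ
  parent : N → N
  adj {u v : N} : T.Adj u v →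
    (depth v = depth u + 1 ∧ parent v = u) ∨ (depth u = depth v + 1 ∧ parent u = v)

theorem nonempty_treeRooting {N : Type*} {T : SimpleGraph N} (hT : T.IsTree) :
    Nonempty (TreeRooting T) := by
  obtain ⟨r⟩ := hT.connected.nonempty
  choose path isPath_path using fun v => (hT.connected v r).exists_isPath
  have snd_path {u v : N} (huv : T.Adj u v) (hdist : T.dist r v = T.dist r u + 1) :
      (path v).snd = u := by
    obtain ⟨p, -, hp⟩ := (hT.connected u r).exists_path_of_dist
    have hcons : (SimpleGraph.Walk.cons huv.symm p).IsPath :=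
      SimpleGraph.Walk.isPath_of_length_eq_dist _ <| by
        rw [SimpleGraph.Walk.length_cons, hp, SimpleGraph.dist_comm, ← hdist,
          SimpleGraph.dist_comm]
    have hpath : path v = SimpleGraph.Walk.cons huv.symm p := congrArg Subtype.val <|
      (hT.isAcyclic.subsingleton_path v r).elim ⟨path v, isPath_path v⟩ ⟨_, hcons⟩
    rw [hpath, SimpleGraph.Walk.snd_cons]
  refine ⟨⟨T.dist r, fun v => (path v).snd, fun {u v} huv => ?_⟩⟩
  rcases hT.dist_eq_dist_add_one_of_adj r huv with h | h
  · exact Or.inr ⟨h, snd_path huv.symm h⟩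
  · exact Or.inl ⟨h, snd_path huv h⟩

namespace TreeRooting

variable {N : Type*} {T : SimpleGraph N} (R : TreeRooting T) {I J : Set N} {x y z : N}

theorem parent_mem_of_preconnected (hI : (T.induce I).Preconnected) (hx : x ∈ I) (hy : y ∈ I)
    (hyx : y ≠ x) (hdepth : R.depth y ≤ R.depth x) :
    R.parent x ∈ I ∧ R.depth x = R.depth (R.parent x) + 1 := by
  let descendants : Set I := {u | ∃ j, R.depth u = R.depth x + j ∧ R.parent^[j] u = x}
  have hy' : (⟨y, hy⟩ : I) ∉ descendants := by
    rintro ⟨j, hj, hjx⟩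
    obtain rfl : j = 0 := by simp only at hj; lia
    exact hyx hjx
  obtain ⟨p⟩ := hI ⟨x, hx⟩ ⟨y, hy⟩
  obtain ⟨e, -, ⟨j, hj, hjx⟩, hsnd⟩ := p.exists_boundary_dart descendants ⟨0, rfl, rfl⟩ hy'
  rcases R.adj (show T.Adj e.fst e.snd from e.adj) with ⟨hd, hp⟩ | ⟨hd, hp⟩
  · exact absurd ⟨j + 1, by lia, by rw [Function.iterate_succ_apply, hp, hjx]⟩ hsnd
  · cases j with
    | zero =>
      obtain rfl : (e.fst : N) = x := hjx
      rw [hp]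
      exact ⟨e.snd.2, hd⟩
    | succ j => exact absurd ⟨j, by lia, by rw [← hp, ← Function.iterate_succ_apply, hjx]⟩ hsnd

theorem top_mem_of_preconnected (hI : (T.induce I).Preconnected) (hJ : (T.induce J).Preconnected)
    (hx : x ∈ I) (hxmin : ∀ v ∈ I, R.depth x ≤ R.depth v) (hy : y ∈ J)
    (hyx : R.depth y ≤ R.depth x) (hzI : z ∈ I) (hzJ : z ∈ J) : x ∈ J := by
  induction hn : R.depth z using Nat.strong_induction_on generalizing z with
  | h n ih =>
    by_cases hzx : z = x
    · exact hzx ▸ hzJ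
    obtain ⟨hparI, hpar⟩ := R.parent_mem_of_preconnected hI hzI hx (Ne.symm hzx) (hxmin z hzI)
    have hyz : y ≠ z := by
      rintro rfl
      have := hxmin _ hparI
      lia
    obtain ⟨hparJ, -⟩ := R.parent_mem_of_preconnected hJ hzJ hy hyz (hyx.trans (hxmin z hzI))
    exact ih _ (by lia) hparI hparJ rfl

end TreeRooting

/-- Two vertex sets touch if they meet or are joined by an edge. -/
def Touches {V : Type*} (H : SimpleGraph V) (K L : Set V) : Prop :=
  ∃ x ∈ K, ∃ y ∈ L, x = y ∨ H.Adj x y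

/-- What is used of a tree decomposition with bags of size at most `b`: every connected vertex set
`K` has a level and at most `b` top vertices (those in the bag of the highest node that meets `K`),
and if two connected sets touch, then the deeper one has a top vertex in the other. -/
structure TopSystem {V : Type*} (H : SimpleGraph V) (b : ℕ) where
  level : Set V → ℕ
  top : Set V → Finset V
  card_top_le (K : Set V) : (top K).card ≤ b
  exists_mem_top {K L : Set V} : (H.induce K).Connected → (H.induce L).Connected →
    Touches H K L → level L ≤ level K → ∃ v ∈ top K, v ∈ L

namespace TreeDecomposition

variable {V : Type u} {H : SimpleGraph V} (D : TreeDecomposition H) {K L : Set V}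

/-- The nodes whose bags meet `K`. -/
def nodes (K : Set V) : Set D.Node := {t | ∃ v ∈ K, v ∈ D.bag t}

theorem nonempty_nodes (hK : K.Nonempty) : (D.nodes K).Nonempty := by
  obtain ⟨v, hv⟩ := hK
  obtain ⟨t, ht⟩ := (D.connected v).nonempty
  exact ⟨t, v, hv, ht⟩

theorem nonempty_nodes_inter (h : Touches H K L) : (D.nodes K ∩ D.nodes L).Nonempty := by
  obtain ⟨x, hx, y, hy, rfl | hxy⟩ := h
  · obtain ⟨t, ht⟩ := (D.connected x).nonempty
    exact ⟨t, ⟨x, hx, ht⟩, ⟨x, hy, ht⟩⟩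
  · obtain ⟨t, htx, hty⟩ := D.edge_mem x y hxy
    exact ⟨t, ⟨x, hx, htx⟩, ⟨y, hy, hty⟩⟩

theorem preconnected_nodes (hK : (H.induce K).Preconnected) :
    (D.tree.induce (D.nodes K)).Preconnected := by
  have reachable_of_mem_bag {v : V} (hv : v ∈ K) (s t : D.nodes K) (hs : v ∈ D.bag s)
      (ht : v ∈ D.bag t) : (D.tree.induce (D.nodes K)).Reachable s t := by
    have hsub : {t | v ∈ D.bag t} ⊆ D.nodes K := fun t ht => ⟨v, hv, ht⟩
    exact ((D.connected v).preconnected ⟨s, hs⟩ ⟨t, ht⟩).map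
      (SimpleGraph.induceHomOfLE D.tree hsub).toHom
  have reachable_of_walk {u v : K} (p : (H.induce K).Walk u v) (s t : D.nodes K)
      (hs : (u : V) ∈ D.bag s) (ht : (v : V) ∈ D.bag t) :
      (D.tree.induce (D.nodes K)).Reachable s t := by
    induction p generalizing s with
    | nil => exact reachable_of_mem_bag (Subtype.property _) s t hs ht
    | @cons u v w huv _ ih =>
      obtain ⟨r, hru, hrv⟩ := D.edge_mem u v huv
      exact (reachable_of_mem_bag u.2 s ⟨r, u, u.2, hru⟩ hs hru).trans (ih _ hrv ht)
  rintro ⟨s, u, hu, hus⟩ ⟨t, v, hv, hvt⟩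
  obtain ⟨p⟩ := hK ⟨u, hu⟩ ⟨v, hv⟩
  exact reachable_of_walk p _ _ hus hvt

theorem nonempty_topSystem [Finite V] {b : ℕ} (hb : ∀ t, (D.bag t).ncard ≤ b) :
    Nonempty (TopSystem H b) := by
  have := D.finite
  obtain ⟨R⟩ := nonempty_treeRooting D.isTree
  have exists_highest (K : Set V) :
      ∃ x, K.Nonempty → x ∈ D.nodes K ∧ ∀ y ∈ D.nodes K, R.depth x ≤ R.depth y := by
    by_cases hK : K.Nonempty
    · obtain ⟨x, hx⟩ :=
        Set.exists_min_image (D.nodes K) R.depth (Set.toFinite _) (D.nonempty_nodes hK)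
      exact ⟨x, fun _ => hx⟩
    · obtain ⟨r⟩ := D.isTree.connected.nonempty
      exact ⟨r, fun h => absurd h hK⟩
  choose highest hhighest using exists_highest
  refine ⟨⟨fun K => R.depth (highest K), fun K => (D.bag (highest K)).toFinite.toFinset,
    fun K => ?_, fun {K L} hK hL hKL hlevel => ?_⟩⟩
  · rw [← Set.ncard_eq_toFinset_card]
    exact hb _
  · obtain ⟨z, hzK, hzL⟩ := D.nonempty_nodes_inter hKL
    obtain ⟨x, hx, y, hy, -⟩ := hKL
    obtain ⟨hK_mem, hK_min⟩ := hhighest K ⟨x, hx⟩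
    obtain ⟨v, hvL, hv⟩ := R.top_mem_of_preconnected (D.preconnected_nodes hK.preconnected)
      (D.preconnected_nodes hL.preconnected) hK_mem hK_min (hhighest L ⟨y, hy⟩).1 hlevel hzK hzL
    exact ⟨v, by simpa using hv, hvL⟩

end TreeDecomposition

theorem exists_treeDecomposition_of_treewidth_le {V : Type u} {H : SimpleGraph V} {w : ℕ}
    (h : treewidth H ≤ w) : ∃ D : TreeDecomposition H, D.width ≤ w := by
  by_contra! hwidth
  have hle : ((w + 1 : ℕ) : ℕ∞) ≤ treewidth H := le_iInf fun D => by
    exact_mod_cast Order.add_one_le_of_lt (hwidth D)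
  have : w + 1 ≤ w := by exact_mod_cast hle.trans h
  lia

theorem nonempty_topSystem_of_treewidth_le {V : Type u} [Finite V] {H : SimpleGraph V} {w : ℕ}
    (h : treewidth H ≤ w) : Nonempty (TopSystem H (w + 1)) := by
  obtain ⟨D, hD⟩ := exists_treeDecomposition_of_treewidth_le h
  refine D.nonempty_topSystem fun t => ?_
  have hbag : (D.bag t).encard ≤ w + 1 :=
    (le_iSup (fun t => (D.bag t).encard) t).trans (tsub_le_iff_right.mp hD)
  rw [← (D.bag t).toFinite.cast_ncard_eq] at hbag
  exact_mod_cast hbag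

theorem connected_induce_singleton {V : Type*} (H : SimpleGraph V) (v : V) :
    (H.induce {v}).Connected := by
  rw [SimpleGraph.induce_singleton_eq_top]
  exact SimpleGraph.connected_top

namespace TopSystem

variable {V : Type*} {H : SimpleGraph V} {b : ℕ} (T : TopSystem H b)

theorem exists_mem_top_or {K L : Set V} (hK : (H.induce K).Connected) (hL : (H.induce L).Connected)
    (h : Touches H K L) : (∃ v ∈ T.top K, v ∈ L) ∨ ∃ v ∈ T.top L, v ∈ K := by
  obtain ⟨x, hx, y, hy, hxy⟩ := id h
  exact (le_total (T.level L) (T.level K)).imp (T.exists_mem_top hK hL h)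
    (T.exists_mem_top hL hK ⟨y, hy, x, hx, hxy.imp Eq.symm fun h => h.symm⟩)

theorem mem_top_singleton_or {u v : V} (huv : H.Adj u v) : v ∈ T.top {u} ∨ u ∈ T.top {v} := by
  simpa using T.exists_mem_top_or (connected_induce_singleton H u) (connected_induce_singleton H v)
    ⟨u, rfl, v, rfl, Or.inr huv⟩

end TopSystem

section MatchingGadget

open Finset
open scoped Classical

/-! ### Covers and hubs -/

theorem card_le_card_of_pairwiseDisjoint {ι α : Type*} {s : Finset ι} {f : ι → Finset α}
    {Y : Finset α} (hs : (s : Set ι).PairwiseDisjoint f) (hY : ∀ i ∈ s, (f i ∩ Y).Nonempty) :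
    #s ≤ #Y :=
  (card_le_card_biUnion (hs.mono_on fun _ _ => inter_subset_left) hY).trans
    (card_le_card (biUnion_subset.mpr fun _ _ => inter_subset_right))

section Covers

variable {V : Type*} {H F : SimpleGraph V} {M S Y : Finset V}

/-- The vertex cover number of a finite graph, as a natural number. -/
noncomputable def coverNum (F : SimpleGraph V) : ℕ := F.vertexCoverNum.toNat

theorem natCast_coverNum [Finite V] (F : SimpleGraph V) : (coverNum F : ℕ∞) = F.vertexCoverNum :=
  ENat.natCast_toNat F.vertexCoverNum_ne_top_of_finite

theorem coverNum_le_card (hY : F.IsVertexCover Y) : coverNum F ≤ #Y := by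
  refine ENat.toNat_le_of_le_natCast ?_
  rw [← Set.encard_coe_eq_coe_finsetCard]
  exact hY.vertexCoverNum_le

theorem exists_isVertexCover_card_eq [Finite V] (F : SimpleGraph V) :
    ∃ Y : Finset V, F.IsVertexCover Y ∧ #Y = coverNum F := by
  obtain ⟨Y, hcard, hY⟩ := F.vertexCoverNum_exists
  lift Y to Finset V using Y.toFinite
  rw [Set.encard_coe_eq_coe_finsetCard, ← natCast_coverNum] at hcard
  exact ⟨Y, hY, by exact_mod_cast hcard⟩

variable [Fintype V]

/-- The closed neighborhood of a vertex set. -/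
noncomputable def closedNbhd (H : SimpleGraph V) (M : Finset V) : Finset V :=
  {v | v ∈ M ∨ ∃ m ∈ M, H.Adj m v}

theorem mem_closedNbhd {v : V} : v ∈ closedNbhd H M ↔ v ∈ M ∨ ∃ m ∈ M, H.Adj m v := by
  simp only [closedNbhd, mem_filter_univ]

theorem mem_closedNbhd_pair {u v z : V} :
    z ∈ closedNbhd H {u, v} ↔ (z = u ∨ H.Adj u z) ∨ (z = v ∨ H.Adj v z) := by
  simp only [mem_closedNbhd, mem_insert, mem_singleton, exists_eq_or_imp, exists_eq_left]
  tauto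

theorem mem_closedNbhd_of_adj {m v : V} (hm : m ∈ M) (h : H.Adj m v) : v ∈ closedNbhd H M :=
  mem_closedNbhd.mpr (Or.inr ⟨m, hm, h⟩)

theorem subset_closedNbhd : M ⊆ closedNbhd H M := fun _ hv => mem_closedNbhd.mpr (Or.inl hv)

/-- The number of common neighbors in `H - S`. -/
noncomputable def codegree (H : SimpleGraph V) (S : Finset V) (u v : V) : ℕ :=
  #{x | x ∉ S ∧ H.Adj x u ∧ H.Adj x v}

theorem codegree_anti {S' : Finset V} (h : S ⊆ S') (u v : V) :
    codegree H S' u v ≤ codegree H S u v :=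
  card_le_card fun x hx => by
    simp only [mem_filter_univ] at hx ⊢
    exact ⟨fun hxS => hx.1 (h hxS), hx.2⟩

theorem codegree_comm (H : SimpleGraph V) (S : Finset V) (u v : V) :
    codegree H S u v = codegree H S v u := by
  simp only [codegree, and_comm (a := H.Adj _ u)]

/-- The graph of the edges of `H - S` that lie in fewer than `t` triangles of `H - S`. -/
def lowEdgeGraph (H : SimpleGraph V) (S : Finset V) (t : ℕ) : SimpleGraph V where
  Adj u v := u ∉ S ∧ v ∉ S ∧ H.Adj u v ∧ codegree H S u v < t
  symm := ⟨fun u v h => ⟨h.2.1, h.1, h.2.2.1.symm, codegree_comm H S u v ▸ h.2.2.2⟩⟩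
  loopless := ⟨fun _ h => H.irrefl h.2.2.1⟩

theorem lowEdgeGraph_le (H : SimpleGraph V) (S : Finset V) (t : ℕ) : lowEdgeGraph H S t ≤ H :=
  fun _ _ huv => huv.2.2.1

/-- The graph of the edges of `F` whose closed neighborhood in `H` contains `z`. -/
def nearGraph (H F : SimpleGraph V) (z : V) : SimpleGraph V where
  Adj u v := F.Adj u v ∧ z ∈ closedNbhd H {u, v}
  symm := ⟨fun u v h => ⟨h.1.symm, pair_comm u v ▸ h.2⟩⟩
  loopless := ⟨fun _ h => F.irrefl h.1⟩

/-- The vertices for which the nearby edges of `F` have vertex cover number at least `h`. -/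
noncomputable def hubs (H F : SimpleGraph V) (h : ℝ) : Finset V :=
  {z | h ≤ coverNum (nearGraph H F z)}

theorem mem_hubs {h : ℝ} {z : V} : z ∈ hubs H F h ↔ h ≤ coverNum (nearGraph H F z) := by
  simp only [hubs, mem_filter_univ]

theorem hubs_anti {h h' : ℝ} (hh : h ≤ h') : hubs H F h' ⊆ hubs H F h := fun _ hz =>
  mem_hubs.mpr (hh.trans (mem_hubs.mp hz))

end Covers

/-! ### Isomorphisms between complements of small sets -/

section Swap

variable {V : Type*} {H : SimpleGraph V} {S M D : Finset V} {φ : V → V}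

/-- `φ` restricts to a boundary preserving isomorphism from `H - M` to `H - D`. -/
structure IsSwap (H : SimpleGraph V) (M D : Finset V) (φ : V → V) : Prop where
  bijOn : Set.BijOn φ (M : Set V)ᶜ (D : Set V)ᶜ
  adj_iff {x y : V} : x ∉ M → y ∉ M → (H.Adj (φ x) (φ y) ↔ H.Adj x y)
  bdry_iff {x : V} : x ∉ M → ((∃ m ∈ M, H.Adj x m) ↔ ∃ w ∈ D, H.Adj (φ x) w)

/-- `S` is protected from the removal of `M`: every boundary preserving isomorphism defined on
`H - M` maps `S` into itself. -/
def IsProtected (H : SimpleGraph V) (S M : Finset V) : Prop :=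
  ∀ D φ, IsSwap H M D φ → Set.MapsTo φ S S

namespace IsSwap

theorem injOn (hφ : IsSwap H M D φ) {A : Finset V} (hA : Disjoint M A) : Set.InjOn φ A :=
  hφ.bijOn.injOn.mono fun _ ha hm => disjoint_left.mp hA hm ha

theorem mem_iff (hφ : IsSwap H M D φ) (hMS : Disjoint M S) (hS : Set.MapsTo φ S S) {x : V}
    (hx : x ∉ M) : φ x ∈ S ↔ x ∈ S := by
  refine ⟨fun h => ?_, fun h => hS h⟩
  obtain ⟨s, hs, hsx⟩ := surjOn_of_injOn_of_card_le φ hS (hφ.injOn hMS) le_rfl h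
  exact hφ.bijOn.injOn (fun hm => disjoint_left.mp hMS hm hs) hx hsx ▸ hs

variable [Fintype V] {t : ℕ} {u v z : V}

theorem codegree_le_of_notMem_closedNbhd (hφ : IsSwap H M D φ) (hS : Set.MapsTo φ S S)
    (hu : u ∉ closedNbhd H M) (hv : v ∉ M) : codegree H S (φ u) (φ v) ≤ codegree H S u v := by
  have huM : u ∉ M := fun h => hu (subset_closedNbhd h)
  have hbdry : ¬ ∃ w ∈ D, H.Adj (φ u) w := by
    rw [← hφ.bdry_iff huM]
    rintro ⟨m, hm, hum⟩
    exact hu (mem_closedNbhd_of_adj hm hum.symm)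
  refine card_le_card_of_surjOn φ fun x hx => ?_
  obtain ⟨hxS, hxu, hxv⟩ := (mem_filter_univ _).mp hx
  obtain ⟨y, hy, rfl⟩ := hφ.bijOn.surjOn fun hxD => hbdry ⟨x, hxD, hxu.symm⟩
  exact ⟨y, by simpa using ⟨fun h => hxS (hS h), (hφ.adj_iff hy huM).mp hxu,
    (hφ.adj_iff hy hv).mp hxv⟩, rfl⟩

theorem map_lowEdgeGraph_adj (hφ : IsSwap H M D φ) (hMS : Disjoint M S) (hS : Set.MapsTo φ S S)
    (hu : u ∉ M) (hv : v ∉ M) (huv : (lowEdgeGraph H S t).Adj u v)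
    (hnear : ¬ (u ∈ closedNbhd H M ∧ v ∈ closedNbhd H M)) :
    (lowEdgeGraph H S t).Adj (φ u) (φ v) := by
  wlog h : u ∉ closedNbhd H M generalizing u v
  · exact (this hv hu huv.symm (fun h => hnear h.symm)
      fun hvM => hnear ⟨not_not.mp h, hvM⟩).symm
  obtain ⟨huS, hvS, hadj, hcod⟩ := huv
  exact ⟨(hφ.mem_iff hMS hS hu).not.mpr huS, (hφ.mem_iff hMS hS hv).not.mpr hvS,
    (hφ.adj_iff hu hv).mpr hadj, (hφ.codegree_le_of_notMem_closedNbhd hS h hv).trans_lt hcod⟩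

theorem map_mem_closedNbhd_pair (hφ : IsSwap H M D φ) (hu : u ∉ M) (hv : v ∉ M) (hz : z ∉ M)
    (h : z ∈ closedNbhd H {u, v}) : φ z ∈ closedNbhd H {φ u, φ v} := by
  rw [mem_closedNbhd_pair] at h ⊢
  exact h.imp (Or.imp (congrArg φ) (hφ.adj_iff hu hz).mpr)
    (Or.imp (congrArg φ) (hφ.adj_iff hv hz).mpr)

end IsSwap

variable [Fintype V] {t : ℕ}

theorem notMem_of_lowEdgeGraph_adj {u v : V} (huv : (lowEdgeGraph H S t).Adj u v)
    (hnear : ¬ (u ∈ closedNbhd H M ∧ v ∈ closedNbhd H M)) : u ∉ M := fun hu =>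
  hnear ⟨subset_closedNbhd hu, mem_closedNbhd_of_adj hu huv.2.2.1⟩

/-- The swap permutes the finitely many low edges, so none of them has an endpoint in `D`. -/
theorem IsSwap.not_lowEdgeGraph_adj (hφ : IsSwap H M D φ) (hMS : Disjoint M S)
    (hS : Set.MapsTo φ S S) (hindep : (lowEdgeGraph H S t).IsIndepSet (closedNbhd H M : Set V))
    {u : V} (hu : u ∈ D) (v : V) : ¬ (lowEdgeGraph H S t).Adj u v := by
  intro huv
  have hnear {u v : V} (h : (lowEdgeGraph H S t).Adj u v) :
      ¬ (u ∈ closedNbhd H M ∧ v ∈ closedNbhd H M) := fun hM => hindep hM.1 hM.2 h.ne h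
  have hnotMem {u v : V} (h : (lowEdgeGraph H S t).Adj u v) : u ∉ M :=
    notMem_of_lowEdgeGraph_adj h (hnear h)
  let lowEdges : Finset (V × V) := {p | (lowEdgeGraph H S t).Adj p.1 p.2}
  have hmem {p : V × V} : p ∈ lowEdges ↔ (lowEdgeGraph H S t).Adj p.1 p.2 := mem_filter_univ _
  have hmaps : Set.MapsTo (Prod.map φ φ) lowEdges lowEdges := fun p hp =>
    have hadj := hmem.mp hp
    hmem.mpr (hφ.map_lowEdgeGraph_adj hMS hS (hnotMem hadj) (hnotMem hadj.symm) hadj (hnear hadj))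
  have hinj : Set.InjOn (Prod.map φ φ) lowEdges := fun p hp q hq hpq => Prod.ext
    (hφ.bijOn.injOn (hnotMem (hmem.mp hp)) (hnotMem (hmem.mp hq)) (congrArg Prod.fst hpq))
    (hφ.bijOn.injOn (hnotMem (hmem.mp hp).symm) (hnotMem (hmem.mp hq).symm) (congrArg Prod.snd hpq))
  obtain ⟨p, hp, hpuv⟩ : (u, v) ∈ Prod.map φ φ '' lowEdges :=
    surjOn_of_injOn_of_card_le _ hmaps hinj le_rfl (hmem.mpr huv)
  have hpu : φ p.1 = u := congrArg Prod.fst hpuv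
  exact hφ.bijOn.mapsTo (hnotMem (hmem.mp hp)) (hpu ▸ hu)

/-- A cover near `φ z` pulls back to a cover near `z`, except for the edges with both endpoints in
the closed neighborhood of `M`. -/
theorem IsSwap.coverNum_nearGraph_le (hφ : IsSwap H M D φ) (hMS : Disjoint M S)
    (hS : Set.MapsTo φ S S) {Y : Finset V} (hY : (lowEdgeGraph H S t).IsVertexCover Y) {z : V}
    (hz : z ∉ M) :
    coverNum (nearGraph H (lowEdgeGraph H S t) z) ≤
      coverNum (nearGraph H (lowEdgeGraph H S t) (φ z)) + #(Y ∩ (closedNbhd H M \ S)) := by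
  obtain ⟨W, hW, hWcard⟩ := exists_isVertexCover_card_eq (nearGraph H (lowEdgeGraph H S t) (φ z))
  let W' : Finset V := {x | x ∉ M ∧ φ x ∈ W}
  have hW'card : #W' ≤ #W := card_le_card_of_injOn φ (fun x hx => ((mem_filter_univ _).mp hx).2)
    (hφ.bijOn.injOn.mono fun x hx => ((mem_filter_univ _).mp hx).1)
  suffices hcover : (nearGraph H (lowEdgeGraph H S t) z).IsVertexCover
      (W' ∪ Y ∩ (closedNbhd H M \ S) : Finset V) by
    have := (coverNum_le_card hcover).trans (card_union_le _ _)
    lia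
  rintro u v ⟨huv, hnear⟩
  by_cases hM : u ∈ closedNbhd H M ∧ v ∈ closedNbhd H M
  · refine (hY huv).imp (fun h => ?_) fun h => ?_ <;>
      refine mem_union_right _ (mem_inter.mpr ⟨h, mem_sdiff.mpr ?_⟩)
    · exact ⟨hM.1, huv.1⟩
    · exact ⟨hM.2, huv.2.1⟩
  · have hu : u ∉ M := notMem_of_lowEdgeGraph_adj huv hM
    have hv : v ∉ M := notMem_of_lowEdgeGraph_adj huv.symm fun h => hM h.symm
    exact (hW ⟨hφ.map_lowEdgeGraph_adj hMS hS hu hv huv hM,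
      hφ.map_mem_closedNbhd_pair hu hv hz hnear⟩).imp
      (fun h => mem_union_left _ ((mem_filter_univ _).mpr ⟨hu, h⟩))
      (fun h => mem_union_left _ ((mem_filter_univ _).mpr ⟨hv, h⟩))

theorem IsProtected.union_hubs {Y : Finset V} {h c : ℝ} (hS : IsProtected H S M)
    (hM : Disjoint M (S ∪ hubs H (lowEdgeGraph H S t) h))
    (hY : (lowEdgeGraph H S t).IsVertexCover Y)
    (hgap : hubs H (lowEdgeGraph H S t) (h - c) ⊆ hubs H (lowEdgeGraph H S t) h)
    (hc : #(Y ∩ (closedNbhd H M \ S)) ≤ c) :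
    IsProtected H (S ∪ hubs H (lowEdgeGraph H S t) h) M := by
  intro D φ hφ z hz
  have hzM : z ∉ M := fun hzM => disjoint_left.mp hM hzM hz
  rcases mem_union.mp hz with hz | hz
  · exact mem_union_left _ (hS D φ hφ hz)
  refine mem_union_right _ (hgap (mem_hubs.mpr ?_))
  have hle : (coverNum (nearGraph H (lowEdgeGraph H S t) z) : ℝ) ≤
      coverNum (nearGraph H (lowEdgeGraph H S t) (φ z)) + #(Y ∩ (closedNbhd H M \ S)) := by
    exact_mod_cast
      hφ.coverNum_nearGraph_le (hM.mono_right subset_union_left) (hS D φ hφ) hY hzM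
  linarith [mem_hubs.mp hz]

end Swap

/-! ### Matchings and scattered edges -/

section Matching

theorem isKMatching_of_existsUnique_adj {W : Type*} [Fintype W] {G : SimpleGraph W} {k : ℕ}
    (hG : ∀ v, ∃! w, G.Adj v w) (hbip : G.IsBipartite) (hcard : Fintype.card W = 2 * k) :
    IsKMatching G k := by
  obtain ⟨χ⟩ := hbip
  choose partner adj_partner eq_partner using hG
  have hinvol (v : W) : partner (partner v) = v := (eq_partner _ v (adj_partner v).symm).symm
  have hcolor (v : W) : χ (partner v) ≠ χ v := fun h => χ.valid (adj_partner v) h.symm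
  let g : {v // χ v = 0} × Bool → W := fun x => if x.2 then partner x.1 else x.1
  have hflip (x : {v // χ v = 0} × Bool) : g (x.1, !x.2) = partner (g x) := by
    rcases x with ⟨v, _ | _⟩
    · rfl
    · exact (hinvol v).symm
  have hg : Function.Bijective g := by
    refine ⟨?_, fun v => ?_⟩
    · rintro ⟨⟨v, hv⟩, s⟩ ⟨⟨w, hw⟩, s'⟩ hvw
      cases s <;> cases s' <;> simp only [g, if_true, if_false, Bool.false_eq_true] at hvw
      · simp [hvw]
      · exact absurd ((congrArg χ hvw).symm.trans (hv.trans hw.symm)) (hcolor w)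
      · exact absurd ((congrArg χ hvw).trans (hw.trans hv.symm)) (hcolor v)
      · simp [(Function.Involutive.injective hinvol hvw : v = w)]
    · by_cases hv : χ v = 0
      · exact ⟨(⟨v, hv⟩, false), rfl⟩
      · exact ⟨(⟨partner v, by have := hcolor v; lia⟩, true), hinvol v⟩
  have hk : Fintype.card {v // χ v = 0} = k := by
    have := Fintype.card_of_bijective hg
    simp only [Fintype.card_prod, Fintype.card_bool] at this
    lia
  let e : Fin k × Bool ≃ W := ((Fintype.equivFinOfCardEq hk).symm.prodCongr (Equiv.refl Bool)).trans
    (Equiv.ofBijective g hg)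
  have hflip' (x : Fin k × Bool) : e (x.1, !x.2) = partner (e x) := hflip (_, x.2)
  have hadj (x y : Fin k × Bool) : G.Adj (e x) (e y) ↔ (disjointEdges k).Adj x y :=
    calc G.Adj (e x) (e y) ↔ e y = e (x.1, !x.2) := by
          rw [hflip']
          exact ⟨eq_partner _ _, fun h => h ▸ adj_partner _⟩
      _ ↔ y = (x.1, !x.2) := e.injective.eq_iff
      _ ↔ x.1 = y.1 ∧ x.2 ≠ y.2 := by
          rw [Prod.ext_iff, eq_comm, ← Bool.eq_not, eq_comm (a := y.2), Bool.not_eq_eq_eq_not]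
  exact ⟨(⟨e, fun {x y} => hadj x y⟩ : disjointEdges k ≃g G).symm⟩

variable {V : Type*} {H : SimpleGraph V} {S D : Finset V} {k : ℕ}

theorem isKMatching_induce_of_existsUnique_adj (hD : ∀ x ∈ D, ∃! y, y ∈ D ∧ H.Adj x y)
    (hbip : (H.induce (D : Set V)).IsBipartite) (hcard : #D = 2 * k) :
    IsKMatching (H.induce (D : Set V)) k := by
  refine isKMatching_of_existsUnique_adj (fun x => ?_) hbip (by simpa using hcard)
  obtain ⟨y, ⟨hy, hxy⟩, huniq⟩ := hD x x.2
  exact ⟨⟨y, hy⟩, hxy, fun z hz => Subtype.ext (huniq z ⟨z.2, hz⟩)⟩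

/-- The set of endpoints of a family of edges. -/
noncomputable def endpoints (E : Finset (V × V)) : Finset V := E.biUnion fun e => {e.1, e.2}

theorem mem_endpoints {E : Finset (V × V)} {x : V} :
    x ∈ endpoints E ↔ ∃ e ∈ E, x = e.1 ∨ x = e.2 := by
  simp only [endpoints, mem_biUnion, mem_insert, mem_singleton]

variable [Fintype V]

/-- The members of `E` are edges of `H - S` whose closed neighborhoods in `H - S` are pairwise
disjoint. -/
structure IsScattered (H : SimpleGraph V) (S : Finset V) (E : Finset (V × V)) : Prop where
  adj : ∀ e ∈ E, H.Adj e.1 e.2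
  notMem : ∀ e ∈ E, e.1 ∉ S ∧ e.2 ∉ S
  pairwiseDisjoint : (E : Set (V × V)).PairwiseDisjoint fun e => closedNbhd H {e.1, e.2} \ S

namespace IsScattered

variable {E E' : Finset (V × V)} {x y : V} {e e' : V × V}

theorem mono (h : IsScattered H S E) (hE : E' ⊆ E) : IsScattered H S E' :=
  ⟨fun e he => h.adj e (hE he), fun e he => h.notMem e (hE he), h.pairwiseDisjoint.subset hE⟩

theorem disjoint (h : IsScattered H S E) : Disjoint (endpoints E) S := by
  rw [disjoint_left]
  intro x hx
  obtain ⟨e, he, rfl | rfl⟩ := mem_endpoints.mp hx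
  exacts [(h.notMem e he).1, (h.notMem e he).2]

theorem eq_of_mem_closedNbhd (h : IsScattered H S E) (he : e ∈ E) (he' : e' ∈ E) (hx : x ∉ S)
    (hxe : x ∈ closedNbhd H {e.1, e.2}) (hxe' : x ∈ closedNbhd H {e'.1, e'.2}) : e = e' :=
  h.pairwiseDisjoint.elim_finset he he' x (mem_sdiff.mpr ⟨hxe, hx⟩) (mem_sdiff.mpr ⟨hxe', hx⟩)

theorem exists_eq_of_adj (h : IsScattered H S E) (hx : x ∉ S) (he : e ∈ E)
    (hxe : x ∈ closedNbhd H {e.1, e.2}) (hy : y ∈ endpoints E) (hxy : H.Adj x y) :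
    y = e.1 ∨ y = e.2 := by
  obtain ⟨e', he', hye'⟩ := mem_endpoints.mp hy
  obtain rfl : e = e' := h.eq_of_mem_closedNbhd he he' hx hxe
    (mem_closedNbhd_of_adj (by simpa using hye') hxy.symm)
  exact hye'

theorem existsUnique_adj (h : IsScattered H S E) (hx : x ∈ endpoints E) :
    ∃! y, y ∈ endpoints E ∧ H.Adj x y := by
  have hxS : x ∉ S := fun hxS => disjoint_left.mp h.disjoint hx hxS
  obtain ⟨e, he, hxe⟩ := mem_endpoints.mp hx
  have honly : ∀ y, y ∈ endpoints E ∧ H.Adj x y → y = e.1 ∨ y = e.2 := fun y hy =>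
    h.exists_eq_of_adj hxS he (subset_closedNbhd (by simpa using hxe)) hy.1 hy.2
  rcases hxe with rfl | rfl
  · exact ⟨e.2, ⟨mem_endpoints.mpr ⟨e, he, Or.inr rfl⟩, h.adj e he⟩,
      fun y hy => (honly y hy).resolve_left hy.2.ne'⟩
  · exact ⟨e.1, ⟨mem_endpoints.mpr ⟨e, he, Or.inl rfl⟩, (h.adj e he).symm⟩,
      fun y hy => (honly y hy).resolve_right hy.2.ne'⟩

theorem card_endpoints (h : IsScattered H S E) : #(endpoints E) = 2 * #E := by
  have hdisj : (E : Set (V × V)).PairwiseDisjoint fun e => ({e.1, e.2} : Finset V) := by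
    refine h.pairwiseDisjoint.mono_on fun e he x hx => mem_sdiff.mpr ⟨subset_closedNbhd hx, ?_⟩
    rcases mem_insert.mp hx with rfl | hx
    · exact (h.notMem e he).1
    · exact mem_singleton.mp hx ▸ (h.notMem e he).2
  rw [endpoints, card_biUnion hdisj, sum_congr rfl fun e he => card_pair (h.adj e he).ne,
    sum_const, smul_eq_mul, mul_comm]

theorem isBipartite (h : IsScattered H S E) : (H.induce (endpoints E : Set V)).IsBipartite := by
  have hmem_iff {e : V × V} (he : e ∈ E) {x : V} (hx : x = e.1 ∨ x = e.2) :
      x ∈ E.image Prod.fst ↔ x = e.1 := by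
    refine ⟨fun hxE => ?_, fun hxe => mem_image.mpr ⟨e, he, hxe.symm⟩⟩
    obtain ⟨e', he', rfl⟩ := mem_image.mp hxE
    exact congrArg Prod.fst (h.eq_of_mem_closedNbhd he' he (h.notMem e' he').1
      (subset_closedNbhd (by simp)) (subset_closedNbhd (by simpa using hx)))
  refine ⟨SimpleGraph.Coloring.mk (fun x => if (x : V) ∈ E.image Prod.fst then 0 else 1)
    fun {x y} hxy hcolor => ?_⟩
  have hadj : H.Adj x y := hxy
  obtain ⟨e, he, hxe⟩ := mem_endpoints.mp x.2
  have hye := h.exists_eq_of_adj (fun hS => disjoint_left.mp h.disjoint x.2 hS) he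
    (subset_closedNbhd (by simpa using hxe)) y.2 hadj
  simp only [hmem_iff he hxe, hmem_iff he hye] at hcolor
  have := hadj.ne
  split_ifs at hcolor <;> grind

theorem isKMatching (h : IsScattered H S E) :
    IsKMatching (H.induce (endpoints E : Set V)) #E :=
  isKMatching_induce_of_existsUnique_adj (fun _ hx => h.existsUnique_adj hx) h.isBipartite
    h.card_endpoints

end IsScattered

end Matching

/-! ### Counting adjacent pairs -/

section Counting

variable {V : Type*} {H : SimpleGraph V} {S M D A B C : Finset V} {φ : V → V}
  {E : Finset (V × V)} {t : ℕ}

theorem card_interedges_eq_sum (H : SimpleGraph V) (A B : Finset V) :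
    #(H.interedges A B) = ∑ x ∈ A, #{y ∈ B | H.Adj x y} := by
  simp only [SimpleGraph.interedges, Rel.interedges, card_filter, sum_product]

theorem card_interedges_comm (H : SimpleGraph V) (A B : Finset V) :
    #(H.interedges A B) = #(H.interedges B A) :=
  have : Std.Symm H.Adj := ⟨fun _ _ h => h.symm⟩
  Rel.card_interedges_comm A B

theorem card_interedges_add_sdiff (hAB : A ⊆ B) (C : Finset V) :
    #(H.interedges A C) + #(H.interedges (B \ A) C) = #(H.interedges B C) := by
  rw [card_interedges_eq_sum, card_interedges_eq_sum, card_interedges_eq_sum, add_comm,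
    sum_sdiff hAB]

theorem exists_isIndepSet_sdiff_isIndepSet (hD : (H.induce (D : Set V)).IsBipartite) :
    ∃ L ⊆ D, H.IsIndepSet L ∧ H.IsIndepSet (D \ L : Finset V) ∧ #D ≤ 2 * #L := by
  obtain ⟨χ⟩ := hD
  let P : Finset V := {x ∈ D | ∃ hx : x ∈ D, χ ⟨x, hx⟩ = 0}
  have hPD : P ⊆ D := filter_subset _ _
  have hmem {x : V} (hx : x ∈ D) : x ∈ P ↔ χ ⟨x, hx⟩ = 0 := by simp [P, hx]
  have hvalid {x y : V} (hx : x ∈ D) (hy : y ∈ D) (hxy : H.Adj x y) : χ ⟨x, hx⟩ ≠ χ ⟨y, hy⟩ :=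
    χ.valid hxy
  have hP : H.IsIndepSet P := fun x hx y hy _ hxy => hvalid (hPD hx) (hPD hy) hxy <|
    ((hmem (hPD hx)).mp hx).trans ((hmem (hPD hy)).mp hy).symm
  have hDP : H.IsIndepSet (D \ P : Finset V) := fun x hx y hy _ hxy => by
    obtain ⟨hxD, hxP⟩ := mem_sdiff.mp hx
    obtain ⟨hyD, hyP⟩ := mem_sdiff.mp hy
    have := hvalid hxD hyD hxy
    have := (hmem hxD).not.mp hxP
    have := (hmem hyD).not.mp hyP
    lia
  have hcard := card_sdiff_add_card_eq_card hPD
  rcases le_total #(D \ P) #P with hle | hle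
  · exact ⟨P, hPD, hP, hDP, by lia⟩
  · exact ⟨D \ P, sdiff_subset, hDP, by rwa [Finset.sdiff_sdiff_eq_self hPD], by lia⟩

theorem ite_add_card_common_le {L : Finset V} (hL : L ⊆ D) {c : V → V}
    (hc : ∀ x ∈ L, c x ∈ D \ L) (y : V) :
    (if ∃ m ∈ D, H.Adj y m then 1 else 0) + #{x ∈ L | H.Adj y x ∧ H.Adj y (c x)} ≤
      #{x ∈ D | H.Adj y x} := by
  have hsub : {x ∈ L | H.Adj y x ∧ H.Adj y (c x)} ⊆ {x ∈ D | H.Adj y x} := fun x hx => by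
    obtain ⟨hxL, hyx, -⟩ := mem_filter.mp hx
    exact mem_filter.mpr ⟨hL hxL, hyx⟩
  split_ifs with hex
  · obtain ⟨m, hm, hym⟩ := hex
    rw [add_comm, Nat.add_one_le_iff]
    refine card_lt_card (hsub.ssubset_of_ne fun heq => ?_)
    obtain ⟨hmL, -, hyc⟩ := mem_filter.mp (heq ▸ mem_filter.mpr ⟨hm, hym⟩)
    obtain ⟨hcD, hcL⟩ := mem_sdiff.mp (hc m hmL)
    exact hcL (mem_filter.mp (heq ▸ mem_filter.mpr ⟨hcD, hyc⟩)).1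
  · rw [zero_add]
    exact card_le_card hsub

namespace IsSwap

theorem card_eq [Finite V] (hφ : IsSwap H M D φ) : #D = #M := by
  have hcompl : (M : Set V)ᶜ.ncard = (D : Set V)ᶜ.ncard := by
    rw [← hφ.bijOn.image_eq, hφ.bijOn.injOn.ncard_image]
  have hM := Set.ncard_add_ncard_compl (M : Set V)
  have hD := Set.ncard_add_ncard_compl (D : Set V)
  rw [Set.ncard_coe_finset] at hM hD
  lia

theorem image_eq (hφ : IsSwap H M D φ) (hMS : Disjoint M S) (hS : Set.MapsTo φ S S) :
    S.image φ = S :=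
  eq_of_subset_of_card_le (image_subset_iff.mpr hS) (card_image_of_injOn (hφ.injOn hMS)).ge

theorem disjoint (hφ : IsSwap H M D φ) (hMS : Disjoint M S) (hS : Set.MapsTo φ S S) :
    Disjoint D S := by
  rw [← hφ.image_eq hMS hS, disjoint_left]
  intro x hxD hxS
  obtain ⟨s, hs, rfl⟩ := mem_image.mp hxS
  exact hφ.bijOn.mapsTo (fun hsM => disjoint_left.mp hMS hsM hs) hxD

theorem card_interedges_image (hφ : IsSwap H M D φ) (hA : Disjoint M A) (hB : Disjoint M B) :
    #(H.interedges (A.image φ) (B.image φ)) = #(H.interedges A B) := by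
  rw [card_interedges_eq_sum, card_interedges_eq_sum, sum_image (hφ.injOn hA)]
  refine sum_congr rfl fun x hx => ?_
  rw [filter_image, card_image_of_injOn ((hφ.injOn hB).mono (filter_subset _ _))]
  exact congrArg card (filter_congr fun y hy => hφ.adj_iff
    (fun h => disjoint_left.mp hA h hx) fun h => disjoint_left.mp hB h hy)

end IsSwap

variable [Fintype V]

theorem card_interedges_add_compl (H : SimpleGraph V) (A B : Finset V) :
    #(H.interedges A B) + #(H.interedges A Bᶜ) = #(H.interedges A univ) := by
  rw [card_interedges_comm H A B, card_interedges_comm H A Bᶜ, card_interedges_comm H A univ,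
    compl_eq_univ_sdiff, card_interedges_add_sdiff (subset_univ B)]

theorem card_interedges_univ (H : SimpleGraph V) (A : Finset V) : #(H.interedges univ univ) =
    #(H.interedges Aᶜ Aᶜ) + 2 * #(H.interedges Aᶜ A) + #(H.interedges A A) := by
  have huniv := card_interedges_add_compl H univ A
  have hA := card_interedges_add_compl H A A
  have hAc := card_interedges_add_compl H Aᶜ A
  rw [card_interedges_comm H univ A, card_interedges_comm H univ Aᶜ] at huniv
  rw [card_interedges_comm H A Aᶜ] at hA
  lia

/-- The vertices outside `M` and `S` that have a neighbor in `M`. -/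
noncomputable def outerNbhd (H : SimpleGraph V) (S M : Finset V) : Finset V :=
  {x ∈ Mᶜ \ S | ∃ m ∈ M, H.Adj x m}

theorem sum_ite_exists_adj (H : SimpleGraph V) (S M : Finset V) :
    (∑ x ∈ Mᶜ \ S, if ∃ m ∈ M, H.Adj x m then 1 else 0) = #(outerNbhd H S M) :=
  (card_filter _ _).symm

namespace IsSwap

theorem image_compl (hφ : IsSwap H M D φ) : Mᶜ.image φ = Dᶜ := by
  rw [← coe_inj, coe_image, coe_compl, coe_compl, hφ.bijOn.image_eq]

theorem image_outerNbhd (hφ : IsSwap H M D φ) (hMS : Disjoint M S) (hS : Set.MapsTo φ S S) :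
    (outerNbhd H S M).image φ = outerNbhd H S D := by
  have hinj : Set.InjOn φ (Mᶜ : Finset V) := hφ.injOn disjoint_compl_right
  have hsdiff : (Mᶜ \ S).image φ = Dᶜ \ S := by
    rw [image_sdiff_of_injOn hinj (subset_compl_iff_disjoint_left.mpr hMS), hφ.image_compl,
      hφ.image_eq hMS hS]
  rw [outerNbhd, outerNbhd, ← hsdiff, filter_image]
  exact congrArg _ (filter_congr fun x hx =>
    hφ.bdry_iff (mem_compl.mp (mem_sdiff.mp hx).1))

/-- The degree sum of `H`, and that of the vertices of `S`, are unaffected by the swap. -/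
theorem two_mul_card_interedges_add (hφ : IsSwap H M D φ) (hMS : Disjoint M S)
    (hS : Set.MapsTo φ S S) :
    2 * #(H.interedges (Dᶜ \ S) D) + #(H.interedges D D) =
      2 * #(H.interedges (Mᶜ \ S) M) + #(H.interedges M M) := by
  have hM : Disjoint M Mᶜ := disjoint_compl_right
  have hcompl := hφ.card_interedges_image hM hM
  have hScompl := hφ.card_interedges_image hMS hM
  rw [hφ.image_compl] at hcompl hScompl
  rw [hφ.image_eq hMS hS] at hScompl
  have hSM := card_interedges_add_compl H S M
  have hSD := card_interedges_add_compl H S D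
  have := card_interedges_univ H M
  have := card_interedges_univ H D
  have := card_interedges_add_sdiff (H := H) (subset_compl_iff_disjoint_left.mpr hMS) M
  have := card_interedges_add_sdiff (H := H)
    (subset_compl_iff_disjoint_left.mpr (hφ.disjoint hMS hS)) D
  lia

end IsSwap

theorem card_neighbors_endpoints_le (h : IsScattered H S E) {x : V} (hx : x ∉ S) :
    #{y ∈ endpoints E | H.Adj x y} ≤
      (if ∃ m ∈ endpoints E, H.Adj x m then 1 else 0) + #{e ∈ E | H.Adj x e.1 ∧ H.Adj x e.2} := by
  split_ifs with hex
  · obtain ⟨m, hm, hxm⟩ := hex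
    obtain ⟨e, he, hme⟩ := mem_endpoints.mp hm
    have hxe : x ∈ closedNbhd H {e.1, e.2} := mem_closedNbhd_of_adj (by simpa using hme) hxm.symm
    have hsub : {y ∈ endpoints E | H.Adj x y} ⊆ ({e.1, e.2} : Finset V).filter (H.Adj x) :=
      fun y hy => by
        obtain ⟨hy, hxy⟩ := mem_filter.mp hy
        exact mem_filter.mpr ⟨by simpa using h.exists_eq_of_adj hx he hxe hy hxy, hxy⟩
    refine (card_le_card hsub).trans ?_
    by_cases hboth : H.Adj x e.1 ∧ H.Adj x e.2
    · have : 0 < #{e ∈ E | H.Adj x e.1 ∧ H.Adj x e.2} := card_pos.mpr ⟨e, by simp [he, hboth]⟩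
      have := (card_filter_le {e.1, e.2} (H.Adj x)).trans card_le_two
      lia
    · have : #(({e.1, e.2} : Finset V).filter (H.Adj x)) ≤ 1 := card_le_one.mpr <| by
        simp only [mem_filter, mem_insert, mem_singleton]
        grind
      lia
  · simp [filter_eq_empty_iff.mpr fun y hy hxy => hex ⟨y, hy, hxy⟩]

theorem card_interedges_endpoints_le (h : IsScattered H S E)
    (hcod : ∀ e ∈ E, codegree H S e.1 e.2 ≤ t) :
    #(H.interedges ((endpoints E)ᶜ \ S) (endpoints E)) ≤
      #(outerNbhd H S (endpoints E)) + #E * t := by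
  rw [card_interedges_eq_sum, ← sum_ite_exists_adj]
  refine (sum_le_sum fun x hx => card_neighbors_endpoints_le h (mem_sdiff.mp hx).2).trans ?_
  rw [sum_add_distrib]
  refine Nat.add_le_add_left ?_ _
  refine (sum_card_bipartiteAbove_eq_sum_card_bipartiteBelow
    fun x (e : V × V) => H.Adj x e.1 ∧ H.Adj x e.2).trans_le ?_
  refine sum_le_card_nsmul _ _ _ fun e he => le_trans (card_le_card fun x hx => ?_) (hcod e he)
  obtain ⟨hx, hadj⟩ := mem_filter.mp hx
  exact (mem_filter_univ _).mpr ⟨(mem_sdiff.mp hx).2, hadj⟩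

theorem card_interedges_endpoints_self (h : IsScattered H S E) :
    #(H.interedges (endpoints E) (endpoints E)) = 2 * #E := by
  rw [card_interedges_eq_sum, ← h.card_endpoints, card_eq_sum_ones]
  exact sum_congr rfl fun x hx => card_eq_one_iff_existsUnique.mpr <| by
    simpa only [mem_filter] using h.existsUnique_adj hx

theorem le_card_interedges_of_isBipartite (hbip : (H.induce (D : Set V)).IsBipartite)
    (hadj : ∀ x ∈ D, ∃ y ∈ D, H.Adj x y)
    (hcod : ∀ x ∈ D, ∀ y ∈ D, H.Adj x y → t ≤ codegree H S x y) :
    2 * #(outerNbhd H S D) + #D * t ≤ 2 * #(H.interedges (Dᶜ \ S) D) := by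
  obtain ⟨L, hLD, hL, hDL, hcard⟩ := exists_isIndepSet_sdiff_isIndepSet hbip
  choose! c hcD hc using hadj
  have hcL : ∀ x ∈ L, c x ∈ D \ L := fun x hx => mem_sdiff.mpr
    ⟨hcD x (hLD hx), fun hcx => hL hx hcx (hc x (hLD hx)).ne (hc x (hLD hx))⟩
  have hcommon : ∀ x ∈ L, t ≤ #{y ∈ Dᶜ \ S | H.Adj y x ∧ H.Adj y (c x)} := fun x hx => by
    refine (hcod x (hLD hx) _ (hcD x (hLD hx)) (hc x (hLD hx))).trans
      (card_le_card fun y hy => ?_)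
    obtain ⟨hyS, hyx, hyc⟩ := (mem_filter_univ _).mp hy
    refine mem_filter.mpr ⟨mem_sdiff.mpr ⟨mem_compl.mpr fun hyD => ?_, hyS⟩, hyx, hyc⟩
    by_cases hyL : y ∈ L
    · exact hL hyL hx hyx.ne hyx
    · exact hDL (mem_sdiff.mpr ⟨hyD, hyL⟩) (hcL x hx) hyc.ne hyc
  have hsum : #(outerNbhd H S D) + #L * t ≤ #(H.interedges (Dᶜ \ S) D) := by
    rw [card_interedges_eq_sum, ← sum_ite_exists_adj]
    refine le_trans (Nat.add_le_add_left ?_ _) <| sum_add_distrib.ge.trans <|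
      sum_le_sum fun y _ => ite_add_card_common_le hLD hcL y
    rw [← smul_eq_mul]
    exact (card_nsmul_le_sum _ _ _ hcommon).trans_eq
      (sum_card_bipartiteAbove_eq_sum_card_bipartiteBelow fun y x => H.Adj y x ∧ H.Adj y (c x)).symm
  nlinarith [Nat.mul_le_mul_right t hcard]

end Counting

/-! ### The gadget criterion -/

section Criterion

variable {V : Type*} {H : SimpleGraph V} {S M D : Finset V} {E : Finset (V × V)} {t : ℕ}

theorem exists_isSwap_of_isBoundaryPreserving
    (f : H.induce (M : Set V)ᶜ ≃g H.induce (D : Set V)ᶜ) (hf : IsBoundaryPreserving H f) :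
    ∃ φ, IsSwap H M D φ := by
  let φ : V → V := fun x => if hx : x ∈ (M : Set V)ᶜ then f ⟨x, hx⟩ else x
  have hφ {x : V} (hx : x ∉ M) : φ x = f ⟨x, hx⟩ := dif_pos hx
  refine ⟨φ, ⟨fun x hx => ?_, fun x hx y hy hxy => ?_, fun y hy => ?_⟩, fun {x y} hx hy => ?_,
    fun {x} hx => ?_⟩
  · rw [hφ hx]
    exact (f _).2
  · rw [hφ hx, hφ hy] at hxy
    exact congrArg Subtype.val (f.injective (Subtype.ext hxy))
  · obtain ⟨⟨x, hx⟩, hxy⟩ := f.surjective ⟨y, hy⟩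
    exact ⟨x, hx, by rw [hφ hx, hxy]⟩
  · rw [hφ hx, hφ hy]
    exact f.map_adj_iff
  · have hM : (∃ m ∈ M, H.Adj x m) ↔ x ∈ vertexBoundary H (M : Set V)ᶜ := by
      simp [vertexBoundary, hx]
    have hD : (∃ w ∈ D, H.Adj (φ x) w) ↔ φ x ∈ vertexBoundary H (D : Set V)ᶜ := by
      have : φ x ∉ D := hφ hx ▸ (f ⟨x, hx⟩).2
      simp [vertexBoundary, this]
    rw [hM, hD, ← hf, hφ hx]
    refine ⟨fun hb => ⟨⟨x, hx⟩, hb, rfl⟩, ?_⟩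
    rintro ⟨z, hz, hzx⟩
    obtain rfl : z = ⟨x, hx⟩ := f.injective (Subtype.ext hzx)
    exact hz

theorem existsUnique_adj_of_card_interedges_le (hadj : ∀ x ∈ D, ∃ y ∈ D, H.Adj x y)
    (hcard : #(H.interedges D D) ≤ #D) {x : V} (hx : x ∈ D) : ∃! y, y ∈ D ∧ H.Adj x y := by
  have hpos : ∀ x ∈ D, 1 ≤ #{y ∈ D | H.Adj x y} := fun x hx => by
    obtain ⟨y, hy, hxy⟩ := hadj x hx
    exact card_pos.mpr ⟨y, mem_filter.mpr ⟨hy, hxy⟩⟩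
  have hsum : ∑ x ∈ D, 1 = ∑ x ∈ D, #{y ∈ D | H.Adj x y} := by
    rw [card_interedges_eq_sum, card_eq_sum_ones] at hcard
    exact le_antisymm (sum_le_sum hpos) hcard
  simpa only [mem_filter] using
    card_eq_one_iff_existsUnique.mp ((sum_eq_sum_iff_of_le hpos).mp hsum x hx).symm

theorem IsScattered.isMatchingGadget [Fintype V] (h : IsScattered H S E)
    (hcod : ∀ e ∈ E, codegree H S e.1 e.2 ≤ t) (hprot : IsProtected H S (endpoints E))
    (hindep : (lowEdgeGraph H S t).IsIndepSet (closedNbhd H (endpoints E) : Set V)) :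
    IsMatchingGadget H #E (endpoints E : Set V) := by
  refine ⟨h.isKMatching, fun C' f hiso hbip hf => ?_⟩
  obtain ⟨D, rfl⟩ : ∃ D : Finset V, C' = (D : Set V)ᶜ := ⟨C'ᶜ.toFinset, by simp⟩
  obtain ⟨φ, hφ⟩ := exists_isSwap_of_isBoundaryPreserving f hf
  rw [compl_compl] at hiso hbip ⊢
  have hS := hprot D φ hφ
  have hDS := hφ.disjoint h.disjoint hS
  have hcardD : #D = 2 * #E := hφ.card_eq.trans h.card_endpoints
  have hadj : ∀ x ∈ D, ∃ y ∈ D, H.Adj x y := fun x hx => by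
    obtain ⟨y, hxy⟩ := SimpleGraph.exists_adj_iff_not_isIsolated.mpr (hiso ⟨x, hx⟩)
    exact ⟨y, y.2, hxy⟩
  have hcodD : ∀ x ∈ D, ∀ y ∈ D, H.Adj x y → t ≤ codegree H S x y := fun x hx y hy hxy =>
    not_lt.mp fun hlt => hφ.not_lowEdgeGraph_adj h.disjoint hS hindep hx y
      ⟨disjoint_left.mp hDS hx, disjoint_left.mp hDS hy, hxy, hlt⟩
  have hle : #(H.interedges D D) ≤ #D := by
    have := hφ.two_mul_card_interedges_add h.disjoint hS
    have := le_card_interedges_of_isBipartite hbip hadj hcodD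
    have := card_interedges_endpoints_le h hcod
    have := card_interedges_endpoints_self h
    have : #(outerNbhd H S D) = #(outerNbhd H S (endpoints E)) := by
      rw [← hφ.image_outerNbhd h.disjoint hS]
      exact card_image_of_injOn (hφ.injOn (disjoint_compl_right.mono_right
        ((filter_subset _ _).trans sdiff_subset)))
    rw [hcardD] at *
    lia
  exact isKMatching_induce_of_existsUnique_adj
    (fun x => existsUnique_adj_of_card_interedges_le hadj hle) hbip hcardD

end Criterion

/-! ### Counting in graphs of bounded treewidth -/

section Sparse

theorem sum_card_filter_le_of_mem_or_mem {α β : Type*} {X : Finset α} {Y : Finset β}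
    {R : α → β → Prop} (A : α → Finset β) (B : β → Finset α) {m n : ℕ} (hA : ∀ x ∈ X, #(A x) ≤ m)
    (hB : ∀ y ∈ Y, #(B y) ≤ n) (hR : ∀ x ∈ X, ∀ y ∈ Y, R x y → y ∈ A x ∨ x ∈ B y) :
    ∑ x ∈ X, #{y ∈ Y | R x y} ≤ #X * m + #Y * n := by
  have hle : ∀ x ∈ X, #{y ∈ Y | R x y} ≤ #(A x) + #{y ∈ Y | x ∈ B y} := fun x hx => by
    refine (card_le_card fun y hy => ?_).trans (card_union_le _ _)
    obtain ⟨hy, hxy⟩ := mem_filter.mp hy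
    exact mem_union.mpr ((hR x hx y hy hxy).imp_right fun h => mem_filter.mpr ⟨hy, h⟩)
  refine (sum_le_sum hle).trans (sum_add_distrib.trans_le (add_le_add ?_ ?_))
  · exact sum_le_card_nsmul _ _ _ hA
  · refine (sum_card_bipartiteAbove_eq_sum_card_bipartiteBelow fun x y => x ∈ B y).trans_le
      (sum_le_card_nsmul _ _ _ fun y hy => le_trans (card_le_card fun x hx => ?_) (hB y hy))
    exact (mem_filter.mp hx).2

theorem card_filter_not_disjoint_le {ι α : Type*} (E : Finset ι) (K : ι → Finset α)
    (A : Finset α) : #{e ∈ E | ¬ Disjoint A (K e)} ≤ ∑ x ∈ A, #{e ∈ E | x ∈ K e} := by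
  refine (card_le_card fun e he => ?_).trans card_biUnion_le
  obtain ⟨he, hAe⟩ := mem_filter.mp he
  obtain ⟨x, hx, hxe⟩ := not_disjoint_iff.mp hAe
  exact mem_biUnion.mpr ⟨x, hx, mem_filter.mpr ⟨he, hxe⟩⟩

variable {V : Type*} {H : SimpleGraph V} {b : ℕ}

theorem connected_induce_of_forall_exists_adj {K L : Set V} (hL : (H.induce L).Connected)
    (hLK : L ⊆ K) (hK : ∀ x ∈ K, x ∈ L ∨ ∃ m ∈ L, H.Adj m x) : (H.induce K).Connected := by
  obtain ⟨c⟩ := hL.nonempty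
  have hreach {m : V} (hm : m ∈ L) : (H.induce K).Reachable ⟨c, hLK c.2⟩ ⟨m, hLK hm⟩ :=
    (hL.preconnected c ⟨m, hm⟩).map (SimpleGraph.induceHomOfLE H hLK).toHom
  refine SimpleGraph.connected_iff_exists_forall_reachable _ |>.mpr ⟨⟨c, hLK c.2⟩, fun x => ?_⟩
  rcases hK x x.2 with hx | ⟨m, hm, hmx⟩
  · exact hreach hx
  · exact (hreach hm).trans (SimpleGraph.Adj.reachable (u := ⟨m, hLK hm⟩) (v := x) hmx)

/-- The star at `z` in `H - (W \ {z})`, as a vertex set. -/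
def starSet (H : SimpleGraph V) (W : Finset V) (z : V) : Set V := {x | x = z ∨ x ∉ W ∧ H.Adj z x}

theorem connected_induce_starSet (H : SimpleGraph V) (W : Finset V) (z : V) :
    (H.induce (starSet H W z)).Connected :=
  connected_induce_of_forall_exists_adj (connected_induce_singleton H z)
    (by rintro _ rfl; exact Or.inl rfl) fun _ hx => hx.imp_right fun hx => ⟨z, rfl, hx.2⟩

theorem card_interedges_insert {X : Finset V} {v : V} (hv : v ∉ X) :
    #(H.interedges (insert v X) (insert v X)) =
      #(H.interedges X X) + 2 * #{x ∈ X | H.Adj v x} := by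
  simp only [card_interedges_eq_sum, sum_insert hv, card_filter, sum_add_distrib,
    SimpleGraph.irrefl, if_false, H.adj_comm _ v]
  ring

namespace TopSystem

theorem card_interedges_le (T : TopSystem H b) (A B : Finset V) :
    #(H.interedges A B) ≤ #A * b + #B * b := by
  rw [card_interedges_eq_sum]
  exact sum_card_filter_le_of_mem_or_mem (fun u => T.top {u}) (fun v => T.top {v})
    (fun _ _ => T.card_top_le _) (fun _ _ => T.card_top_le _)
    fun _ _ _ _ huv => T.mem_top_singleton_or huv

/-- Whatever meets the deepest set of a family meets it in one of its top vertices. -/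
theorem exists_forall_not_disjoint_top (T : TopSystem H b) {ι : Type*} {E : Finset ι}
    (hE : E.Nonempty) {K : ι → Finset V} (hK : ∀ e ∈ E, (H.induce (K e : Set V)).Connected) :
    ∃ e ∈ E, ∀ e' ∈ E, Disjoint (T.top (K e)) (K e') → Disjoint (K e) (K e') := by
  obtain ⟨e, he, hmax⟩ := exists_max_image E (fun e => T.level (K e)) hE
  refine ⟨e, he, fun e' he' => not_imp_not.mp fun hmeet => ?_⟩
  obtain ⟨x, hx, hx'⟩ := not_disjoint_iff.mp hmeet
  obtain ⟨v, hv, hv'⟩ := T.exists_mem_top (hK e he) (hK e' he') ⟨x, hx, x, hx', Or.inl rfl⟩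
    (hmax e' he')
  exact not_disjoint_iff.mpr ⟨v, hv, hv'⟩

/-- Greedily take the deepest set; it only excludes sets that contain one of its top vertices. -/
theorem exists_pairwiseDisjoint (T : TopSystem H b) {ι : Type*} (E : Finset ι)
    (K : ι → Finset V) (hK : ∀ e ∈ E, (H.induce (K e : Set V)).Connected) {q : ℝ}
    (hq : ∀ x, (#{e ∈ E | x ∈ K e} : ℝ) ≤ q) :
    ∃ D ⊆ E, (D : Set ι).PairwiseDisjoint K ∧ (#E : ℝ) ≤ b * q * #D := by
  induction E using Finset.strongInduction with
  | H E ih =>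
    rcases E.eq_empty_or_nonempty with rfl | hE
    · exact ⟨∅, Subset.rfl, by simp, by simp⟩
    obtain ⟨e, he, hdisj⟩ := T.exists_forall_not_disjoint_top hE hK
    let E' : Finset ι := {e' ∈ E | Disjoint (T.top (K e)) (K e')}
    have hE'E : E' ⊆ E := filter_subset _ _
    obtain ⟨x, hx⟩ := (hK e he).nonempty
    have heE' : e ∉ E' := fun h => by
      have := hdisj e he (mem_filter.mp h).2
      exact disjoint_left.mp this hx hx
    obtain ⟨D, hDE', hD, hcard⟩ := ih E' (hE'E.ssubset_of_mem_notMem he heE')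
      (fun e he => hK e (hE'E he)) fun x => le_trans
        (by exact_mod_cast card_le_card (filter_subset_filter _ hE'E)) (hq x)
    have hexcluded : (#{e' ∈ E | ¬ Disjoint (T.top (K e)) (K e')} : ℝ) ≤ b * q := by
      have hq0 : 0 ≤ q := (Nat.cast_nonneg _).trans (hq x)
      calc (#{e' ∈ E | ¬ Disjoint (T.top (K e)) (K e')} : ℝ)
        _ ≤ ∑ x ∈ T.top (K e), (#{e ∈ E | x ∈ K e} : ℝ) := by
          exact_mod_cast card_filter_not_disjoint_le E K _
        _ ≤ #(T.top (K e)) * q :=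
          (sum_le_card_nsmul _ _ q fun x _ => hq x).trans_eq (nsmul_eq_mul _ _)
        _ ≤ b * q := mul_le_mul_of_nonneg_right (by exact_mod_cast T.card_top_le _) hq0
    refine ⟨insert e D, insert_subset he (hDE'.trans hE'E), ?_, ?_⟩
    · rw [coe_insert]
      exact hD.insert fun e' he' _ => hdisj e' (hE'E (hDE' he')) (mem_filter.mp (hDE' he')).2
    · have hsplit : (#E : ℝ) = #E' + #{e' ∈ E | ¬ Disjoint (T.top (K e)) (K e')} := by
        exact_mod_cast (card_filter_add_card_filter_not (s := E)
          fun e' => Disjoint (T.top (K e)) (K e')).symm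
      rw [card_insert_of_notMem fun h => heE' (hDE' h), hsplit]
      push_cast
      linarith

/-- Take `X ⊇ Y` maximizing the number of edges in `X` minus `2 * b * #X`. -/
theorem exists_superset_card_neighbors_le [Finite V] (T : TopSystem H b) (hb : 0 < b)
    (Y : Finset V) :
    ∃ X, Y ⊆ X ∧ #X ≤ 2 * #Y ∧ ∀ v ∉ X, #{x ∈ X | H.Adj v x} ≤ 2 * b := by
  have := Fintype.ofFinite V
  obtain ⟨X, hX, hmax⟩ := exists_max_image {X : Finset V | Y ⊆ X}
    (fun X => (#(H.interedges X X) : ℤ) - 4 * b * #X) ⟨Y, by simp⟩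
  have hYX : Y ⊆ X := (mem_filter_univ _).mp hX
  refine ⟨X, hYX, ?_, fun v hv => ?_⟩
  · have hedges : (#(H.interedges X X) : ℤ) ≤ #X * b + #X * b := by
      exact_mod_cast T.card_interedges_le X X
    have hle : (b : ℤ) * #X ≤ b * (2 * #Y) := by linarith [hmax Y (by simp)]
    exact_mod_cast le_of_mul_le_mul_left hle (by exact_mod_cast hb)
  · have hle := hmax (insert v X) (by simpa using hYX.trans (subset_insert v X))
    rw [card_interedges_insert hv, card_insert_of_notMem hv] at hle
    push_cast at hle
    lia

end TopSystem

variable [Fintype V] {F : SimpleGraph V} {X Y Z W : Finset V}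

/-- The vertices with more than `b` neighbors in `Z`. -/
noncomputable def richVertices (H : SimpleGraph V) (b : ℕ) (Z : Finset V) : Finset V :=
  {u | b < #{z ∈ Z | H.Adj u z}}

theorem TopSystem.card_richVertices_le (T : TopSystem H b) (Z : Finset V) :
    #(richVertices H b Z) ≤ b * #Z := by
  have hupper := T.card_interedges_le (richVertices H b Z) Z
  have hlower : #(richVertices H b Z) * (b + 1) ≤ #(H.interedges (richVertices H b Z) Z) := by
    rw [card_interedges_eq_sum]
    exact (smul_eq_mul _ _).ge.trans
      (card_nsmul_le_sum _ _ _ fun u hu => (mem_filter_univ u).mp hu)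
  lia

theorem isVertexCover_nearGraph (hF : F ≤ H) (hY : F.IsVertexCover Y) {z : V} (hz : z ∈ W) :
    (nearGraph H F z).IsVertexCover ({y ∈ Y | Touches H (starSet H W z) {y}} ∪ W : Finset V) := by
  rintro u v ⟨huv, hnear⟩
  wlog h : z = u ∨ H.Adj u z generalizing u v
  · exact (this huv.symm (pair_comm u v ▸ hnear)
      ((mem_closedNbhd_pair.mp hnear).resolve_left h)).symm
  by_cases hu : u ∈ W
  · exact Or.inl (mem_union_right _ hu)
  have hzu : H.Adj u z := h.resolve_left fun h => hu (h ▸ hz)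
  have hustar : u ∈ starSet H W z := Or.inr ⟨hu, hzu.symm⟩
  exact (hY huv).imp
    (fun h => mem_union_left _ (mem_filter.mpr ⟨h, u, hustar, u, rfl, Or.inl rfl⟩))
    (fun h => mem_union_left _ (mem_filter.mpr ⟨h, u, hustar, v, rfl, Or.inr (hF huv)⟩))

theorem TopSystem.sum_card_touches_starSet_le (T : TopSystem H b) (hW : richVertices H b Z ⊆ W)
    (Y : Finset V) :
    ∑ z ∈ Z, #{y ∈ Y | Touches H (starSet H W z) {y}} ≤ #Z * b + #Y * (b + b * b) := by
  refine sum_card_filter_le_of_mem_or_mem (fun z => T.top (starSet H W z))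
    (fun y => T.top {y} ∪ (T.top {y} \ W).biUnion fun x => {z ∈ Z | H.Adj x z})
    (fun _ _ => T.card_top_le _) (fun y _ => ?_) fun z hz y _ hzy => ?_
  · refine (card_union_le _ _).trans (add_le_add (T.card_top_le _) ?_)
    refine (card_biUnion_le_card_mul _ _ b fun x hx => not_lt.mp fun hlt => ?_).trans ?_
    · exact (mem_sdiff.mp hx).2 (hW ((mem_filter_univ _).mpr hlt))
    · exact Nat.mul_le_mul_right _ ((card_le_card sdiff_subset).trans (T.card_top_le _))
  · refine (T.exists_mem_top_or (connected_induce_starSet H W z) (connected_induce_singleton H y)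
      hzy).imp (by rintro ⟨_, hv, rfl⟩; exact hv) ?_
    rintro ⟨v, hv, rfl | ⟨hvW, hzv⟩⟩
    · exact mem_union_left _ hv
    · exact mem_union_right _ (mem_biUnion.mpr
        ⟨v, mem_sdiff.mpr ⟨hv, hvW⟩, mem_filter.mpr ⟨hz, hzv.symm⟩⟩)

theorem TopSystem.card_mul_le_of_subset_hubs (T : TopSystem H b) (hF : F ≤ H)
    (hY : F.IsVertexCover Y) {h : ℝ} (hZ : Z ⊆ hubs H F h) :
    (#Z : ℝ) * (h - (b + 1) * #Z) ≤ #Z * b + #Y * (b + b * b) := by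
  have hrich : (#(richVertices H b Z) : ℝ) ≤ b * #Z := by exact_mod_cast T.card_richVertices_le Z
  set W := richVertices H b Z ∪ Z
  have hlower : ∀ z ∈ Z, h - (b + 1) * #Z ≤ (#{y ∈ Y | Touches H (starSet H W z) {y}} : ℝ) := by
    intro z hz
    have hcover : (coverNum (nearGraph H F z) : ℝ) ≤
        #{y ∈ Y | Touches H (starSet H W z) {y}} + (#(richVertices H b Z) + #Z) := by
      exact_mod_cast (coverNum_le_card (isVertexCover_nearGraph hF hY (mem_union_right _ hz))).trans
        ((card_union_le _ _).trans (Nat.add_le_add_left (card_union_le _ _) _))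
    linarith [mem_hubs.mp (hZ hz)]
  calc (#Z : ℝ) * (h - (b + 1) * #Z)
    _ ≤ ∑ z ∈ Z, (#{y ∈ Y | Touches H (starSet H W z) {y}} : ℝ) :=
      (nsmul_eq_mul _ _).ge.trans (card_nsmul_le_sum _ _ _ hlower)
    _ ≤ #Z * b + #Y * (b + b * b) := by
      exact_mod_cast T.sum_card_touches_starSet_le subset_union_left Y

theorem TopSystem.card_hubs_lt (T : TopSystem H b) (hF : F ≤ H) (hY : F.IsVertexCover Y) {ε : ℝ}
    {p : ℕ} (hp : 2 * (b + b * b + 1 : ℝ) ≤ ε * p) (hn : (b + 1) * (p * p) + b * p < #Y) :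
    #(hubs H F (ε * #Y)) < p := by
  by_contra! hle
  obtain ⟨Z, hZ, hZp⟩ := exists_subset_card_eq hle
  have hcount := T.card_mul_le_of_subset_hubs hF hY hZ
  rw [hZp] at hcount
  have hn' : ((b + 1) * (p * p) + b * p : ℝ) < #Y := by exact_mod_cast hn
  have hpY : 2 * (b + b * b + 1 : ℝ) * #Y ≤ ε * p * #Y :=
    mul_le_mul_of_nonneg_right hp (Nat.cast_nonneg _)
  have : (0 : ℝ) ≤ (b + b * b) * #Y := by positivity
  nlinarith

/-! ### Edges in few triangles -/

/-- The deepest vertex `v` outside `X` that has a neighbor outside `X` has at most `b` of them. -/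
theorem TopSystem.exists_adj_codegree_le (T : TopSystem H b) {d : ℕ}
    (hd : ∀ v ∉ X, #{x ∈ X | H.Adj v x} ≤ d) (hX : ¬ H.IsVertexCover X) :
    ∃ v ∉ X, ∃ u ∉ X, H.Adj v u ∧ codegree H ∅ v u ≤ d + b := by
  obtain ⟨u₀, v₀, hadj, hu₀, hv₀⟩ : ∃ u v, H.Adj u v ∧ u ∉ X ∧ v ∉ X := by
    simpa [SimpleGraph.IsVertexCover] using hX
  obtain ⟨v, hv, hvmax⟩ := exists_max_image {v | v ∉ X ∧ ∃ u ∉ X, H.Adj v u}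
    (fun v => T.level {v}) ⟨u₀, by simpa using ⟨hu₀, v₀, hv₀, hadj⟩⟩
  obtain ⟨hvX, u, huX, hvu⟩ := (mem_filter_univ _).mp hv
  refine ⟨v, hvX, u, huX, hvu, ?_⟩
  have hsub : ({x | x ∉ (∅ : Finset V) ∧ H.Adj x v ∧ H.Adj x u} : Finset V) ⊆
      {x ∈ X | H.Adj v x} ∪ T.top {v} := fun x hx => by
    obtain ⟨-, hxv, -⟩ := (mem_filter_univ _).mp hx
    by_cases hxX : x ∈ X
    · exact mem_union_left _ (mem_filter.mpr ⟨hxX, hxv.symm⟩)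
    · obtain ⟨y, hy, rfl⟩ := T.exists_mem_top (connected_induce_singleton H v)
        (connected_induce_singleton H x) ⟨v, rfl, x, rfl, Or.inr hxv.symm⟩
        (hvmax x ((mem_filter_univ _).mpr ⟨hxX, v, hvX, hxv⟩))
      exact mem_union_right _ hy
  exact (card_le_card hsub).trans
    ((card_union_le _ _).trans (add_le_add (hd v hvX) (T.card_top_le _)))

theorem TopSystem.coverNum_le_two_mul_coverNum_lowEdgeGraph (T : TopSystem H b) (hb : 0 < b) :
    coverNum H ≤ 2 * coverNum (lowEdgeGraph H ∅ (3 * b + 1)) := by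
  obtain ⟨Y, hY, hcard⟩ := exists_isVertexCover_card_eq (lowEdgeGraph H ∅ (3 * b + 1))
  obtain ⟨X, hYX, hXcard, hX⟩ := T.exists_superset_card_neighbors_le hb Y
  refine (coverNum_le_card ?_).trans (hcard ▸ hXcard)
  by_contra hcover
  obtain ⟨v, hv, u, hu, hvu, hcod⟩ := T.exists_adj_codegree_le hX hcover
  have hlow : (lowEdgeGraph H ∅ (3 * b + 1)).Adj v u :=
    ⟨notMem_empty v, notMem_empty u, hvu, by lia⟩
  exact (hY hlow).elim (fun h => hv (hYX h)) fun h => hu (hYX h)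

end Sparse

/-! ### Matchings, nested sets and gaps -/

section Gaps

theorem exists_subset_of_card_lt {α : Type*} {A : ℕ → Finset α} (hA : Monotone A) {p : ℕ}
    (hp : #(A p) < p) : ∃ j < p, A (j + 1) ⊆ A j := by
  by_contra! hcon
  have hcard : ∀ j ≤ p, j ≤ #(A j) := by
    intro j hj
    induction j with
    | zero => exact Nat.zero_le _
    | succ j ih =>
      have hlt := card_lt_card ⟨hA j.le_succ, hcon j hj⟩
      exact (ih (Nat.le_of_succ_le hj)).trans_lt hlt
  exact (hcard p le_rfl).not_gt hp

theorem card_filter_not_disjoint_le_card {ι α : Type*} {E : Finset ι} {K : ι → Finset α}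
    (hK : (E : Set ι).PairwiseDisjoint K) (A : Finset α) :
    #{e ∈ E | ¬ Disjoint (K e) A} ≤ #A :=
  card_le_card_of_pairwiseDisjoint (hK.subset (filter_subset _ _)) fun _ he =>
    not_disjoint_iff_nonempty_inter.mp (mem_filter.mp he).2

theorem card_filter_not_disjoint_sdiff_le {α : Type*} {Z : ℕ → Finset α} (hZ : Monotone Z)
    (A : Finset α) (n : ℕ) :
    #{i ∈ range n | ¬ Disjoint A (Z (i + 1) \ Z i)} ≤ #(A ∩ Z n) := by
  refine card_le_card_of_pairwiseDisjoint (f := fun i => Z (i + 1) \ Z i) ?_ fun i hi => ?_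
  · refine ((pairwise_disjoint_on _).mpr fun i j hij => ?_).set_pairwise _
    exact disjoint_sdiff.mono_left (sdiff_subset.trans (hZ (Nat.succ_le_of_lt hij)))
  · obtain ⟨hin, hi⟩ := mem_filter.mp hi
    obtain ⟨x, hxA, hx⟩ := not_disjoint_iff.mp hi
    have hxn : x ∈ Z n := hZ (Nat.succ_le_of_lt (mem_range.mp hin)) (mem_sdiff.mp hx).1
    exact ⟨x, mem_inter.mpr ⟨hx, mem_inter.mpr ⟨hxA, hxn⟩⟩⟩

theorem exists_mul_card_filter_le {α : Type*} {E : Finset α} {R : ℕ → α → Prop} [DecidableRel R]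
    {m n : ℕ} (hn : 0 < n) (hR : ∀ e ∈ E, #{i ∈ range n | R i e} ≤ m) :
    ∃ i < n, n * #{e ∈ E | R i e} ≤ m * #E := by
  by_contra! hlt
  have hsum : ∑ i ∈ range n, #{e ∈ E | R i e} ≤ m * #E := by
    rw [mul_comm]
    exact (sum_card_bipartiteAbove_eq_sum_card_bipartiteBelow R).trans_le
      (sum_le_card_nsmul _ _ _ hR)
  have hlower : n * (m * #E) < n * ∑ i ∈ range n, #{e ∈ E | R i e} := by
    rw [mul_sum, ← smul_eq_mul, ← card_range n, ← sum_const, card_range]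
    exact sum_lt_sum_of_nonempty (nonempty_range_iff.mpr hn.ne') fun i hi =>
      hlt i (mem_range.mp hi)
  exact (Nat.mul_le_mul_left n hsum).not_gt hlower

variable {V : Type*} {H F : SimpleGraph V} {S Z : Finset V} {E : Finset (V × V)}

theorem card_le_coverNum_of_pairwiseDisjoint [Finite V]
    (hE : (E : Set (V × V)).PairwiseDisjoint fun e => ({e.1, e.2} : Finset V))
    (hadj : ∀ e ∈ E, F.Adj e.1 e.2) : #E ≤ coverNum F := by
  obtain ⟨Y, hY, hcard⟩ := exists_isVertexCover_card_eq F
  refine (card_le_card_of_pairwiseDisjoint hE fun e he => ?_).trans_eq hcard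
  rcases hY (hadj e he) with h | h
  · exact ⟨e.1, mem_inter.mpr ⟨mem_insert_self _ _, h⟩⟩
  · exact ⟨e.2, mem_inter.mpr ⟨mem_insert_of_mem (mem_singleton_self _), h⟩⟩

theorem exists_pairwiseDisjoint_coverNum_le [Finite V] (F : SimpleGraph V) :
    ∃ E : Finset (V × V), (E : Set (V × V)).PairwiseDisjoint (fun e => ({e.1, e.2} : Finset V)) ∧
      (∀ e ∈ E, F.Adj e.1 e.2) ∧ coverNum F ≤ 2 * #E := by
  have := Fintype.ofFinite V
  obtain ⟨E, hE, hmax⟩ := exists_max_image {E : Finset (V × V) |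
    (E : Set (V × V)).PairwiseDisjoint (fun e => ({e.1, e.2} : Finset V)) ∧
      ∀ e ∈ E, F.Adj e.1 e.2} card ⟨∅, by simp⟩
  obtain ⟨hdisj, hadj⟩ := (mem_filter_univ _).mp hE
  refine ⟨E, hdisj, hadj, (coverNum_le_card (Y := endpoints E) fun u v huv => ?_).trans ?_⟩
  · by_contra! huvE
    have hnew : ∀ e ∈ E, Disjoint ({u, v} : Finset V) {e.1, e.2} := by
      intro e he
      rw [disjoint_right]
      intro x hx hxuv
      have hxE : x ∈ endpoints E := mem_endpoints.mpr ⟨e, he, by simpa using hx⟩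
      rcases mem_insert.mp hxuv with rfl | hxv
      · exact huvE.1 hxE
      · exact huvE.2 (mem_singleton.mp hxv ▸ hxE)
    have huvnot : (u, v) ∉ E := fun h => huvE.1 (mem_endpoints.mpr ⟨_, h, Or.inl rfl⟩)
    refine (hmax (insert (u, v) E) ((mem_filter_univ _).mpr ⟨?_, ?_⟩)).not_gt
      (card_lt_card (ssubset_insert huvnot))
    · rw [coe_insert]
      exact hdisj.insert fun e he _ => hnew e he
    · exact forall_mem_insert _ _ _ |>.mpr ⟨huv, hadj⟩
  · exact (card_biUnion_le_card_mul _ _ 2 fun _ _ => card_le_two).trans_eq (mul_comm _ _)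

variable [Fintype V]

theorem card_closedNbhd_inter_le {b : ℕ} {u v : V}
    (h : Disjoint {u, v} (richVertices H b Z ∪ Z)) : #(closedNbhd H {u, v} ∩ Z) ≤ 2 * b := by
  have hnotMem : ∀ x ∈ ({u, v} : Finset V), x ∉ Z := fun x hx hxZ =>
    disjoint_left.mp h hx (mem_union_right _ hxZ)
  have hcard : ∀ x ∈ ({u, v} : Finset V), #{z ∈ Z | H.Adj x z} ≤ b := fun x hx =>
    not_lt.mp fun hlt => disjoint_left.mp h hx
      (mem_union_left _ ((mem_filter_univ x).mpr hlt))
  calc #(closedNbhd H {u, v} ∩ Z)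
    _ ≤ #(({u, v} : Finset V).biUnion fun x => {z ∈ Z | H.Adj x z}) := card_le_card fun z hz => by
      obtain ⟨hz, hzZ⟩ := mem_inter.mp hz
      obtain hz | ⟨x, hx, hxz⟩ := mem_closedNbhd.mp hz
      · exact absurd hzZ (hnotMem z hz)
      · exact mem_biUnion.mpr ⟨x, hx, mem_filter.mpr ⟨hzZ, hxz⟩⟩
    _ ≤ 2 * b := (card_biUnion_le_card_mul _ _ b hcard).trans (Nat.mul_le_mul_right b card_le_two)

/-- An edge that avoids `Z (8 * b)` and the vertices rich in it is near at most `2 * b` of the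
vertices of `Z (8 * b)`, hence near at most `2 * b` of the `8 * b` differences. -/
theorem TopSystem.exists_scale {b : ℕ} (T : TopSystem H b) (hb : 0 < b)
    (hE : (E : Set (V × V)).PairwiseDisjoint fun e => ({e.1, e.2} : Finset V))
    {Z : ℕ → Finset V} (hZ : Monotone Z) (hcard : 4 * ((b + 1) * #(Z (8 * b))) ≤ #E) :
    ∃ i < 8 * b, ∃ E' ⊆ E, #E ≤ 2 * #E' ∧ ∀ e ∈ E', Disjoint {e.1, e.2} (Z (8 * b)) ∧
      Disjoint (closedNbhd H {e.1, e.2}) (Z (i + 1) \ Z i) := by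
  set P := richVertices H b (Z (8 * b)) ∪ Z (8 * b)
  have hP : #P ≤ (b + 1) * #(Z (8 * b)) := (card_union_le _ _).trans
    ((Nat.add_le_add_right (T.card_richVertices_le _) _).trans_eq (by ring))
  let E₀ : Finset (V × V) := {e ∈ E | Disjoint {e.1, e.2} P}
  have hE₀ : #E₀ + #{e ∈ E | ¬ Disjoint {e.1, e.2} P} = #E := card_filter_add_card_filter_not _
  have hmeet := card_filter_not_disjoint_le_card hE P
  obtain ⟨i, hi, hbad⟩ := exists_mul_card_filter_le (E := E₀) (m := 2 * b) (n := 8 * b)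
    (R := fun i e => ¬ Disjoint (closedNbhd H {e.1, e.2}) (Z (i + 1) \ Z i))
    (by lia) fun e he =>
      (card_filter_not_disjoint_sdiff_le hZ _ _).trans
        (card_closedNbhd_inter_le (mem_filter.mp he).2)
  have hfew : 4 * #{e ∈ E₀ | ¬ Disjoint (closedNbhd H {e.1, e.2}) (Z (i + 1) \ Z i)} ≤ #E₀ :=
    Nat.le_of_mul_le_mul_left (by linarith) (Nat.mul_pos two_pos hb)
  have hsplit : #{e ∈ E₀ | Disjoint (closedNbhd H {e.1, e.2}) (Z (i + 1) \ Z i)} +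
    #{e ∈ E₀ | ¬ Disjoint (closedNbhd H {e.1, e.2}) (Z (i + 1) \ Z i)} = #E₀ :=
    card_filter_add_card_filter_not _
  refine ⟨i, hi, {e ∈ E₀ | Disjoint (closedNbhd H {e.1, e.2}) (Z (i + 1) \ Z i)},
    (filter_subset _ _).trans (filter_subset _ _), by lia, fun e he => ?_⟩
  obtain ⟨he₀, he⟩ := mem_filter.mp he
  exact ⟨(mem_filter.mp he₀).2.mono_right subset_union_right, he⟩

/-- The edges near a vertex outside `hubs H F h` are at most `h` in number, so that greedy choice
among the closed neighborhoods in `H - S` is efficient. -/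
theorem TopSystem.exists_isScattered {b : ℕ} (T : TopSystem H b) (hF : F ≤ H)
    (hE : (E : Set (V × V)).PairwiseDisjoint fun e => ({e.1, e.2} : Finset V))
    (hadj : ∀ e ∈ E, F.Adj e.1 e.2) (hS : ∀ e ∈ E, Disjoint {e.1, e.2} S) {h h' : ℝ} (hh : 0 ≤ h)
    (hE' : ∀ e ∈ E, Disjoint (closedNbhd H {e.1, e.2}) (hubs H F h \ hubs H F h'))
    (hh' : hubs H F h' ⊆ S) : ∃ D ⊆ E, IsScattered H S D ∧ (#E : ℝ) ≤ b * h * #D := by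
  have hends (e) (he : e ∈ E) : e.1 ∉ S ∧ e.2 ∉ S := by simpa using hS e he
  have hconn : ∀ e ∈ E, (H.induce (↑(closedNbhd H {e.1, e.2} \ S) : Set V)).Connected := by
    intro e he
    refine connected_induce_of_forall_exists_adj
      (SimpleGraph.induce_pair_connected_of_adj (hF (hadj e he))) ?_ fun x hx => ?_
    · rintro x (rfl | rfl)
      · exact mem_sdiff.mpr ⟨subset_closedNbhd (by simp), (hends e he).1⟩
      · exact mem_sdiff.mpr ⟨subset_closedNbhd (by simp), (hends e he).2⟩
    · simpa using mem_closedNbhd.mp (mem_sdiff.mp hx).1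
  have hcount (x : V) : (#{e ∈ E | x ∈ closedNbhd H {e.1, e.2} \ S} : ℝ) ≤ h := by
    by_cases hx : x ∈ hubs H F h
    · have hempty : {e ∈ E | x ∈ closedNbhd H {e.1, e.2} \ S} = ∅ :=
        filter_false_of_mem fun e he hxe => disjoint_left.mp (hE' e he) (mem_sdiff.mp hxe).1
          (mem_sdiff.mpr ⟨hx, fun hxh' => (mem_sdiff.mp hxe).2 (hh' hxh')⟩)
      simpa only [hempty, card_empty, Nat.cast_zero] using hh
    · have hle : #{e ∈ E | x ∈ closedNbhd H {e.1, e.2} \ S} ≤ coverNum (nearGraph H F x) :=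
        card_le_coverNum_of_pairwiseDisjoint (hE.subset (filter_subset _ _)) fun e he =>
          have ⟨he, hxe⟩ := mem_filter.mp he
          ⟨hadj e he, (mem_sdiff.mp hxe).1⟩
      exact le_trans (by exact_mod_cast hle) (not_le.mp (mem_hubs.not.mp hx)).le
  obtain ⟨D, hDE, hD, hcard⟩ := T.exists_pairwiseDisjoint E _ hconn hcount
  exact ⟨D, hDE, ⟨fun e he => hF (hadj e (hDE he)), fun e he => hends e (hDE he), hD⟩, hcard⟩

/-- Apply `exists_subset_of_card_lt` to the hubs for `p + 1` evenly spaced values. -/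
theorem exists_hubs_gap {ε n : ℝ} {p : ℕ} (hεn : 0 ≤ ε * n)
    (hp : #(hubs H F (ε / 2 * n)) < p) :
    ∃ h, ε / 2 * n ≤ h ∧ h ≤ ε * n ∧ hubs H F (h - ε / (2 * p) * n) ⊆ hubs H F h := by
  have hp0 : (0 : ℝ) < p := by exact_mod_cast (Nat.zero_le _).trans_lt hp
  set γ := ε / (2 * p) * n with hγ
  have hγ0 : 0 ≤ γ := by rw [hγ, div_mul_eq_mul_div]; positivity
  have hpγ : p * γ = ε / 2 * n := by rw [hγ]; field_simp
  let A (j : ℕ) : Finset V := hubs H F (ε * n - j * γ)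
  have hA : Monotone A := fun i j hij => hubs_anti (by gcongr)
  have hAp : A p = hubs H F (ε / 2 * n) := by
    simp only [A, hpγ]
    ring_nf
  obtain ⟨j, hj, hsub⟩ := exists_subset_of_card_lt hA (hAp ▸ hp)
  have hjγ : j * γ ≤ p * γ := by gcongr
  have hjγ0 : 0 ≤ j * γ := by positivity
  refine ⟨ε * n - j * γ, by linarith, by linarith, ?_⟩
  convert hsub using 2
  push_cast
  ring

end Gaps

/-! ### Protecting weights -/

section Weights

variable {V : Type*} {μ : V → ℝ} {Y : Finset V}

/-- The average of `μ` and the uniform distribution on `Y`. -/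
noncomputable def averageWeight (μ : V → ℝ) (Y : Finset V) (v : V) : ℝ :=
  (μ v + (if v ∈ Y then 1 else 0) / #Y) / 2

theorem sum_averageWeight (μ : V → ℝ) (Y A : Finset V) :
    ∑ v ∈ A, averageWeight μ Y v = (∑ v ∈ A, μ v + #(Y ∩ A) / #Y) / 2 := by
  simp only [averageWeight, ← sum_div, sum_add_distrib, sum_boole, filter_mem_eq_inter,
    inter_comm A]

theorem averageWeight_mul_le_one {v : V} {R : ℕ} (hμ : μ v * R ≤ 1) (hY : R ≤ #Y) :
    averageWeight μ Y v * R ≤ 1 := by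
  have hY' : (R : ℝ) ≤ #Y := by exact_mod_cast hY
  have huniform : (if v ∈ Y then (1 : ℝ) else 0) / #Y * R ≤ 1 := by
    rw [div_mul_eq_mul_div]
    refine div_le_one_of_le₀ ?_ (Nat.cast_nonneg _)
    split_ifs <;> simp [hY']
  rw [averageWeight]
  linarith

variable [Fintype V] {H : SimpleGraph V} {S M : Finset V} {E : Finset (V × V)} {η : ℝ}
  {k t N : ℕ}

/-- A mass distribution `μ` without atoms heavier than `1 / N` that certifies protection: `S` is
protected from the removal of every `M` whose closed neighborhood in `H - S` has mass at most
`η`. -/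
structure IsProtectingWeight (H : SimpleGraph V) (S : Finset V) (μ : V → ℝ) (η : ℝ) (N : ℕ) :
    Prop where
  nonneg : ∀ v, 0 ≤ μ v
  sum_le_one : ∑ v, μ v ≤ 1
  mul_le_one : ∀ v, μ v * N ≤ 1
  isProtected : ∀ M, Disjoint M S → ∑ v ∈ closedNbhd H M \ S, μ v ≤ η → IsProtected H S M

theorem isProtectingWeight_empty (H : SimpleGraph V) (η : ℝ) (N : ℕ) :
    IsProtectingWeight H ∅ 0 η N where
  nonneg _ := le_rfl
  sum_le_one := by simp
  mul_le_one := by simp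
  isProtected _ _ _ _ _ _ x hx := absurd hx (notMem_empty x)

theorem closedNbhd_endpoints (H : SimpleGraph V) (E : Finset (V × V)) :
    closedNbhd H (endpoints E) = E.biUnion fun e => closedNbhd H {e.1, e.2} := by
  ext v
  simp only [mem_closedNbhd, mem_biUnion, mem_endpoints, mem_insert, mem_singleton]
  grind

theorem closedNbhd_endpoints_sdiff (H : SimpleGraph V) (S : Finset V) (E : Finset (V × V)) :
    closedNbhd H (endpoints E) \ S = E.biUnion fun e => closedNbhd H {e.1, e.2} \ S := by
  ext v
  simp only [closedNbhd_endpoints, mem_sdiff, mem_biUnion]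
  tauto

theorem isIndepSet_closedNbhd (hY : (lowEdgeGraph H S t).IsVertexCover Y)
    (hM : Disjoint (closedNbhd H M \ S) Y) :
    (lowEdgeGraph H S t).IsIndepSet (closedNbhd H M : Set V) := fun _ hu _ hv _ huv =>
  (hY huv).elim (disjoint_left.mp hM (mem_sdiff.mpr ⟨hu, huv.1⟩))
    (disjoint_left.mp hM (mem_sdiff.mpr ⟨hv, huv.2.1⟩))

theorem card_filter_lt_mul_sum_le {ι : Type*} {D : Finset ι} {K : ι → Finset V}
    (hK : (D : Set ι).PairwiseDisjoint K) (hμ : ∀ v, 0 ≤ μ v) (hμ1 : ∑ v, μ v ≤ 1) (hη : 0 < η)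
    {q : ℕ} (hq : k ≤ η * q) : #{e ∈ D | η < k * ∑ v ∈ K e, μ v} ≤ q := by
  set B : Finset ι := {e ∈ D | η < k * ∑ v ∈ K e, μ v}
  have hmass : ∑ e ∈ B, ∑ v ∈ K e, μ v ≤ 1 := by
    rw [← sum_biUnion (hK.subset (filter_subset _ _))]
    exact (sum_le_sum_of_subset_of_nonneg (subset_univ _) fun v _ _ => hμ v).trans hμ1
  have hB : η * #B ≤ η * q :=
    calc η * #B
      _ ≤ ∑ e ∈ B, k * ∑ v ∈ K e, μ v := by
        rw [mul_comm, ← nsmul_eq_mul]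
        exact card_nsmul_le_sum _ _ _ fun e he => (mem_filter.mp he).2.le
      _ ≤ k * 1 := by
        rw [← mul_sum]
        exact mul_le_mul_of_nonneg_left hmass (Nat.cast_nonneg k)
      _ ≤ η * q := by rwa [mul_one]
  exact_mod_cast le_of_mul_le_mul_left hB hη

/-- Discard the edges whose closed neighborhood in `H - S` meets `Y` or is heavier than `η / k`. -/
theorem IsScattered.exists_subset_disjoint_sum_le (h : IsScattered H S E)
    (hμ : ∀ v, 0 ≤ μ v) (hμ1 : ∑ v, μ v ≤ 1) (hη : 0 < η) {q : ℕ} (hq : k ≤ η * q)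
    (hcard : #Y + q + k ≤ #E) :
    ∃ D ⊆ E, #D = k ∧ Disjoint (closedNbhd H (endpoints D) \ S) Y ∧
      ∑ v ∈ closedNbhd H (endpoints D) \ S, μ v ≤ η := by
  let K (e : V × V) : Finset V := closedNbhd H {e.1, e.2} \ S
  have hK : (E : Set (V × V)).PairwiseDisjoint K := h.pairwiseDisjoint
  have hgood : k ≤ #{e ∈ E | Disjoint (K e) Y ∧ k * ∑ v ∈ K e, μ v ≤ η} := by
    have hsub : E ⊆ {e ∈ E | ¬ Disjoint (K e) Y} ∪ {e ∈ E | η < k * ∑ v ∈ K e, μ v} ∪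
        {e ∈ E | Disjoint (K e) Y ∧ k * ∑ v ∈ K e, μ v ≤ η} := fun e he => by
      simp only [mem_union, mem_filter, he, true_and, ← not_le]
      tauto
    have hunion := (card_le_card hsub).trans
      ((card_union_le _ _).trans (Nat.add_le_add_right (card_union_le _ _) _))
    have hmeet := card_filter_not_disjoint_le_card hK Y
    have hheavy := card_filter_lt_mul_sum_le hK hμ hμ1 hη hq
    lia
  obtain ⟨D, hDgood, rfl⟩ := exists_subset_card_eq hgood
  have hDE : D ⊆ E := hDgood.trans (filter_subset _ _)
  have hD (e) (he : e ∈ D) : Disjoint (K e) Y ∧ #D * ∑ v ∈ K e, μ v ≤ η :=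
    (mem_filter.mp (hDgood he)).2
  refine ⟨D, hDE, rfl, ?_, ?_⟩ <;> rw [closedNbhd_endpoints_sdiff]
  · exact (disjoint_biUnion_left _ _ _).mpr fun e he => (hD e he).1
  · rw [sum_biUnion (hK.subset hDE)]
    rcases D.eq_empty_or_nonempty with rfl | hne
    · simpa using hη.le
    · have hpos : (0 : ℝ) < #D := by exact_mod_cast hne.card_pos
      refine le_of_mul_le_mul_left ?_ hpos
      rw [mul_sum, ← nsmul_eq_mul]
      exact sum_le_card_nsmul _ _ _ fun e he => (hD e he).2

theorem IsScattered.exists_isMatchingGadget (h : IsScattered H S E)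
    (hcod : ∀ e ∈ E, codegree H S e.1 e.2 ≤ t) (hμ : IsProtectingWeight H S μ η N) (hη : 0 < η)
    {q : ℕ} (hq : k ≤ η * q) (hcard : coverNum (lowEdgeGraph H S t) + q + k ≤ #E) :
    ∃ M : Set V, IsMatchingGadget H k M := by
  obtain ⟨Y, hY, hYcard⟩ := exists_isVertexCover_card_eq (lowEdgeGraph H S t)
  obtain ⟨D, hDE, rfl, hDY, hDμ⟩ := h.exists_subset_disjoint_sum_le (Y := Y) hμ.nonneg
    hμ.sum_le_one hη hq (by rwa [hYcard])
  exact ⟨_, (h.mono hDE).isMatchingGadget (fun e he => hcod e (hDE he))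
    (hμ.isProtected _ (h.mono hDE).disjoint hDμ) (isIndepSet_closedNbhd hY hDY)⟩

theorem closedNbhd_sdiff_subset (H : SimpleGraph V) (M S Z : Finset V) :
    closedNbhd H M \ S ⊆ closedNbhd H M \ (S ∪ Z) ∪ Z := by
  grind

theorem IsProtectingWeight.union_hubs {η' h γ : ℝ} {p R : ℕ} (hμ : IsProtectingWeight H S μ η N)
    (hY : (lowEdgeGraph H S t).IsVertexCover Y) (hN : 0 < N) (hNY : N ≤ #Y) (hRN : R ≤ N)
    (hgap : hubs H (lowEdgeGraph H S t) (h - γ * #Y) ⊆ hubs H (lowEdgeGraph H S t) h)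
    (hp : #(hubs H (lowEdgeGraph H S t) h) ≤ p) (hηη' : 4 * η' ≤ η) (hγη' : 4 * η' ≤ γ)
    (hηp : 2 * p ≤ η * N) (hγp : 2 * p ≤ γ * #Y) :
    IsProtectingWeight H (S ∪ hubs H (lowEdgeGraph H S t) h) (averageWeight μ Y) η' R where
  nonneg v := by
    have := hμ.nonneg v
    unfold averageWeight
    positivity
  sum_le_one := by
    rw [sum_averageWeight, inter_univ]
    linarith [hμ.sum_le_one, div_self_le_one (#Y : ℝ)]
  mul_le_one v := averageWeight_mul_le_one
    ((mul_le_mul_of_nonneg_left (by exact_mod_cast hRN) (hμ.nonneg v)).trans (hμ.mul_le_one v))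
    (hRN.trans hNY)
  isProtected M hM hweight := by
    set Z := hubs H (lowEdgeGraph H S t) h
    rw [sum_averageWeight] at hweight
    have hsub := closedNbhd_sdiff_subset H M S Z
    have hpZ : (#Z : ℝ) ≤ p := by exact_mod_cast hp
    have hN' : (0 : ℝ) < N := by exact_mod_cast hN
    have hY' : (0 : ℝ) < #Y := by exact_mod_cast hN.trans_le hNY
    have hμ0 (A : Finset V) : 0 ≤ ∑ v ∈ A, μ v := sum_nonneg fun v _ => hμ.nonneg v
    refine (hμ.isProtected M (hM.mono_right subset_union_left) ?_).union_hubs hM hY hgap ?_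
    · have hZ : ∑ v ∈ Z, μ v ≤ η / 2 := by
        have := sum_le_card_nsmul Z (fun v => μ v * N) 1 fun v _ => hμ.mul_le_one v
        rw [← sum_mul, nsmul_eq_mul, mul_one] at this
        exact le_of_mul_le_mul_right (by linarith) hN'
      have hunion := sum_union_inter (s₁ := closedNbhd H M \ (S ∪ Z)) (s₂ := Z) (f := μ)
      have hle := sum_le_sum_of_subset_of_nonneg hsub fun v _ _ => hμ.nonneg v
      have hquot : (0 : ℝ) ≤ #(Y ∩ (closedNbhd H M \ (S ∪ Z))) / #Y := by positivity
      linarith [hμ0 (closedNbhd H M \ (S ∪ Z) ∩ Z)]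
    · have hfew : (#(Y ∩ (closedNbhd H M \ (S ∪ Z))) : ℝ) ≤ 2 * η' * #Y := by
        rw [← div_le_iff₀ hY']
        linarith [hμ0 (closedNbhd H M \ (S ∪ Z))]
      have hle : (#(Y ∩ (closedNbhd H M \ S)) : ℝ) ≤
          #(Y ∩ (closedNbhd H M \ (S ∪ Z))) + #Z := by
        exact_mod_cast (card_le_card ((inter_subset_inter_left hsub).trans (by grind))).trans
          (card_union_le _ _)
      linarith [mul_le_mul_of_nonneg_right hγη' hY'.le]

end Weights

/-! ### Scales and the induction -/

section Scales

/-- With parameter `N`, a set `S` protected by a weight of tolerance `η` suffices for a gadget as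
soon as the edges of `H - S` in fewer than `t` triangles have cover number at least `N`. -/
def GadgetBound (b k t : ℕ) (η : ℝ) (N : ℕ) : Prop :=
  ∀ (V : Type u) [Fintype V] (H : SimpleGraph V) (S : Finset V) (μ : V → ℝ), TopSystem H b →
    IsProtectingWeight H S μ η N → N ≤ coverNum (lowEdgeGraph H S t) →
      ∃ M : Set V, IsMatchingGadget H k M

theorem gadgetBound_zero (b k : ℕ) (η : ℝ) : GadgetBound.{u} b k 0 η 1 := by
  intro V _ H S _ _ _ hcov
  have hempty : (lowEdgeGraph H S 0).IsVertexCover ((∅ : Finset V) : Set V) :=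
    fun u v huv => absurd huv.2.2.2 (Nat.not_lt_zero _)
  exact absurd (hcov.trans (coverNum_le_card hempty)) (by simp)

/-- The parameters of one attempt at the induction step. A vertex is a hub at this scale if the
cover number of the low edges near it is about `size` times that of all low edges or more, and there
are fewer than `hubBound` hubs. Adding them to the protected set lowers the tolerance from `η` to
`tolerance`. If the cover number for `t` is then still at least `coverBound`, induction applies;
otherwise at most `heavyBound` scattered edges are excluded for carrying too much weight. -/
structure Scale (b k t : ℕ) (η : ℝ) where
  size : ℝ
  hubBound : ℕ
  tolerance : ℝ
  coverBound : ℕ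
  heavyBound : ℕ
  size_pos : 0 < size
  tolerance_pos : 0 < tolerance
  le_size_mul_hubBound : 2 * (b + b * b + 1 : ℝ) ≤ size / 2 * hubBound
  four_mul_tolerance_le : 4 * tolerance ≤ η
  four_mul_tolerance_le_gap : 4 * tolerance ≤ size / (2 * hubBound)
  gadgetBound : GadgetBound.{u} b k t tolerance coverBound
  le_tolerance_mul_heavyBound : k ≤ tolerance * heavyBound

namespace Scale

variable {b k t N : ℕ} {η : ℝ}

theorem exists_size_eq (ih : ∀ η > 0, ∃ N, GadgetBound.{u} b k t η N) (hη : 0 < η) {ε : ℝ}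
    (hε : 0 < ε) : ∃ σ : Scale.{u} b k t η, σ.size = ε := by
  obtain ⟨p, hp⟩ := exists_nat_ge (2 * (b + b * b + 1 : ℝ) / (ε / 2))
  have hp0 : (0 : ℝ) < p := lt_of_lt_of_le (by positivity) hp
  rw [div_le_iff₀' (half_pos hε)] at hp
  obtain ⟨τ, hτ, hτmin⟩ : ∃ τ > 0, 4 * τ = min η (ε / (2 * p)) :=
    ⟨min η (ε / (2 * p)) / 4, by positivity, by ring⟩
  obtain ⟨R, hR⟩ := ih τ hτ
  obtain ⟨q, hq⟩ := exists_nat_ge (k / τ)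
  rw [div_le_iff₀' hτ] at hq
  exact ⟨⟨ε, p, τ, R, q, hε, hτ, hp, hτmin.trans_le (min_le_left _ _),
    hτmin.trans_le (min_le_right _ _), hR, hq⟩, rfl⟩

variable (σ σ' : Scale.{u} b k t η)

theorem hubBound_pos : (0 : ℝ) < σ.hubBound := by
  have hpos : (0 : ℝ) < σ.size / 2 * σ.hubBound :=
    lt_of_lt_of_le (by positivity) σ.le_size_mul_hubBound
  exact pos_of_mul_pos_right hpos (half_pos σ.size_pos).le

/-- The number of scattered edges that yields a gadget at this scale. -/
def matchingBound : ℕ :=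
  σ.coverBound + σ.heavyBound + k

/-- The scale `σ'` is so much finer than `σ` that edges with no hubs of scale `σ'` near them contain
a scattered set large enough for `σ`. -/
structure Refines : Prop where
  size_le : σ'.size ≤ σ.size / 2
  size_mul_le_one : 4 * b * σ'.size * σ.matchingBound ≤ 1

theorem exists_refines (ih : ∀ η > 0, ∃ N, GadgetBound.{u} b k t η N) (hη : 0 < η) :
    ∃ σ' : Scale.{u} b k t η, σ.Refines σ' := by
  have hden : (0 : ℝ) < 4 * b * σ.matchingBound + 1 := by positivity
  have hsize := half_pos σ.size_pos
  obtain ⟨σ', hσ'⟩ := exists_size_eq ih hη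
    (lt_min hsize (one_div_pos.mpr hden) : 0 < min (σ.size / 2) (1 / _))
  have hle := hσ'.trans_le (min_le_right _ _)
  rw [le_div_iff₀ hden] at hle
  exact ⟨σ', hσ'.trans_le (min_le_left _ _), by linarith [σ'.size_pos]⟩

theorem exists_seq (ih : ∀ η > 0, ∃ N, GadgetBound.{u} b k t η N) (hη : 0 < η) :
    ∃ σ : ℕ → Scale.{u} b k t η, ∀ i, (σ i).Refines (σ (i + 1)) := by
  choose next hnext using fun σ : Scale.{u} b k t η => σ.exists_refines ih hη
  obtain ⟨σ₀, -⟩ := exists_size_eq ih hη one_pos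
  refine ⟨fun i => next^[i] σ₀, fun i => ?_⟩
  simpa only [Function.iterate_succ_apply'] using hnext _

/-- The cover number `N` is large enough for the estimates at scale `σ`. -/
structure IsLarge (N : ℕ) : Prop where
  lt : (b + 1) * (σ.hubBound * σ.hubBound) + b * σ.hubBound < N
  coverBound_le : σ.coverBound ≤ N
  hubBound_le_mul : 2 * σ.hubBound ≤ η * N
  hubBound_le_gap_mul : 2 * σ.hubBound ≤ σ.size / (2 * σ.hubBound) * N
  hubBound_le : 8 * ((b + 1) * σ.hubBound) ≤ N

open Filter in
theorem eventually_isLarge (hη : 0 < η) : ∀ᶠ N in atTop, σ.IsLarge N := by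
  have hgap : 0 < σ.size / (2 * σ.hubBound) :=
    div_pos σ.size_pos (mul_pos two_pos σ.hubBound_pos)
  have linear {c : ℝ} (hc : 0 < c) : ∀ᶠ N : ℕ in atTop, 2 * (σ.hubBound : ℝ) ≤ c * N :=
    (tendsto_natCast_atTop_atTop.const_mul_atTop hc).eventually_ge_atTop _
  filter_upwards [eventually_gt_atTop ((b + 1) * (σ.hubBound * σ.hubBound) + b * σ.hubBound),
    eventually_ge_atTop σ.coverBound, linear hη, linear hgap,
    eventually_ge_atTop (8 * ((b + 1) * σ.hubBound))] with N h₁ h₂ h₃ h₄ h₅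
  exact ⟨h₁, h₂, h₃, h₄, h₅⟩

variable {σ σ'} {V : Type u} [Fintype V] {H : SimpleGraph V} {S Y : Finset V} {μ : V → ℝ} {s : ℕ}

theorem IsLarge.card_hubs_lt (hN : σ.IsLarge N) (T : TopSystem H b)
    (hY : (lowEdgeGraph H S s).IsVertexCover Y) (hNY : N ≤ #Y) :
    #(hubs H (lowEdgeGraph H S s) (σ.size / 2 * #Y)) < σ.hubBound :=
  T.card_hubs_lt (lowEdgeGraph_le H S s) hY σ.le_size_mul_hubBound (hN.lt.trans_le hNY)

theorem IsLarge.exists_isProtectingWeight (hN : σ.IsLarge N) (T : TopSystem H b)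
    (hμ : IsProtectingWeight H S μ η N) (hY : (lowEdgeGraph H S s).IsVertexCover Y)
    (hNY : N ≤ #Y) :
    ∃ h, σ.size / 2 * #Y ≤ h ∧ h ≤ σ.size * #Y ∧
      IsProtectingWeight H (S ∪ hubs H (lowEdgeGraph H S s) h) (averageWeight μ Y)
        σ.tolerance σ.coverBound := by
  have hhubs := hN.card_hubs_lt T hY hNY
  obtain ⟨h, hh, hh', hgap⟩ := exists_hubs_gap (mul_nonneg σ.size_pos.le (Nat.cast_nonneg #Y)) hhubs
  have hgapY : 2 * σ.hubBound ≤ σ.size / (2 * σ.hubBound) * #Y :=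
    hN.hubBound_le_gap_mul.trans <| mul_le_mul_of_nonneg_left (by exact_mod_cast hNY)
      (div_pos σ.size_pos (mul_pos two_pos σ.hubBound_pos)).le
  exact ⟨h, hh, hh', hμ.union_hubs hY (Nat.zero_lt_of_lt hN.lt) hNY hN.coverBound_le hgap
    ((card_le_card (hubs_anti hh)).trans hhubs.le) σ.four_mul_tolerance_le
    σ.four_mul_tolerance_le_gap hN.hubBound_le_mul hgapY⟩

theorem exists_isMatchingGadget {D : Finset (V × V)} (T : TopSystem H b)
    (hμ : IsProtectingWeight H S μ σ.tolerance σ.coverBound) (hD : IsScattered H S D)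
    (hcod : ∀ e ∈ D, codegree H S e.1 e.2 ≤ t) (hcard : σ.matchingBound ≤ #D) :
    ∃ M : Set V, IsMatchingGadget H k M := by
  rcases le_or_gt σ.coverBound (coverNum (lowEdgeGraph H S t)) with hlarge | hsmall
  · exact σ.gadgetBound V H S μ T hμ hlarge
  · refine hD.exists_isMatchingGadget hcod hμ σ.tolerance_pos σ.le_tolerance_mul_heavyBound ?_
    unfold matchingBound at hcard
    omega

theorem Refines.exists_isScattered {E : Finset (V × V)} {F : SimpleGraph V} {n : ℝ} (hb : 0 < b)
    (hσ : σ.Refines σ') (T : TopSystem H b) (hF : F ≤ H)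
    (hE : (E : Set (V × V)).PairwiseDisjoint fun e => ({e.1, e.2} : Finset V))
    (hadj : ∀ e ∈ E, F.Adj e.1 e.2) (hn : 0 < n) (hnE : n ≤ 4 * #E)
    (hS : ∀ e ∈ E, Disjoint {e.1, e.2} S)
    (hE' : ∀ e ∈ E,
      Disjoint (closedNbhd H {e.1, e.2}) (hubs H F (σ'.size * n) \ hubs H F (σ.size * n)))
    (hhubs : hubs H F (σ.size * n) ⊆ S) :
    ∃ D ⊆ E, IsScattered H S D ∧ σ.matchingBound ≤ #D := by
  obtain ⟨D, hDE, hD, hcard⟩ :=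
    T.exists_isScattered hF hE hadj hS (mul_pos σ'.size_pos hn).le hE' hhubs
  refine ⟨D, hDE, hD, ?_⟩
  have hpos : 0 < 4 * b * σ'.size :=
    mul_pos (mul_pos four_pos (by exact_mod_cast hb)) σ'.size_pos
  have hone : 1 ≤ 4 * b * σ'.size * #D := le_of_mul_le_mul_left (by linarith) hn
  exact_mod_cast le_of_mul_le_mul_left (hσ.size_mul_le_one.trans hone) hpos

theorem antitone_size {σ : ℕ → Scale.{u} b k t η} (hσ : ∀ i, (σ i).Refines (σ (i + 1))) :
    Antitone fun i => (σ i).size :=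
  antitone_nat_of_succ_le fun i => by linarith [(hσ i).size_le, (σ i).size_pos]

theorem exists_pairwiseDisjoint_edges {σ : ℕ → Scale.{u} b k t η} (hb : 0 < b)
    (hσ : ∀ i, (σ i).Refines (σ (i + 1))) (hN : (σ (8 * b)).IsLarge N) (T : TopSystem H b)
    (hY : (lowEdgeGraph H S s).IsVertexCover Y) (hYcard : #Y = coverNum (lowEdgeGraph H S s))
    (hNY : N ≤ #Y) :
    ∃ i < 8 * b, ∃ E : Finset (V × V),
      (E : Set (V × V)).PairwiseDisjoint (fun e => ({e.1, e.2} : Finset V)) ∧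
      (∀ e ∈ E, (lowEdgeGraph H S s).Adj e.1 e.2) ∧ #Y ≤ 4 * #E ∧
      ∀ e ∈ E, Disjoint {e.1, e.2} (hubs H (lowEdgeGraph H S s) ((σ (8 * b)).size * #Y)) ∧
        Disjoint (closedNbhd H {e.1, e.2})
          (hubs H (lowEdgeGraph H S s) ((σ (i + 1)).size * #Y) \
            hubs H (lowEdgeGraph H S s) ((σ i).size * #Y)) := by
  obtain ⟨E, hE, hadj, hEcard⟩ := exists_pairwiseDisjoint_coverNum_le (lowEdgeGraph H S s)
  have hmono : Monotone fun i => hubs H (lowEdgeGraph H S s) ((σ i).size * #Y) := fun i j hij =>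
    hubs_anti (mul_le_mul_of_nonneg_right (antitone_size hσ hij) (Nat.cast_nonneg _))
  have hhubs : #(hubs H (lowEdgeGraph H S s) ((σ (8 * b)).size * #Y)) ≤ (σ (8 * b)).hubBound :=
    (card_le_card (hubs_anti (mul_le_mul_of_nonneg_right (half_le_self (σ (8 * b)).size_pos.le)
      (Nat.cast_nonneg _)))).trans (hN.card_hubs_lt T hY hNY).le
  obtain ⟨i, hi, E', hE'E, hcard, hE'⟩ := T.exists_scale hb hE hmono (by
    have := Nat.mul_le_mul_left (b + 1) hhubs
    have := hN.hubBound_le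
    omega)
  exact ⟨i, hi, E', hE.subset hE'E, fun e he => hadj e (hE'E he), by omega, hE'⟩

end Scale

theorem exists_gadgetBound_succ {b k t : ℕ} (hb : 0 < b)
    (ih : ∀ η > 0, ∃ N, GadgetBound.{u} b k t η N) {η : ℝ} (hη : 0 < η) :
    ∃ N, GadgetBound.{u} b k (t + 1) η N := by
  obtain ⟨σ, hσ⟩ := Scale.exists_seq ih hη
  obtain ⟨N, hN⟩ := ((Filter.eventually_all_finset (range (8 * b + 1))).mpr fun i _ =>
    (σ i).eventually_isLarge hη).exists
  have hlarge (i) (hi : i ≤ 8 * b) : (σ i).IsLarge N := hN i (mem_range_succ_iff.mpr hi)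
  refine ⟨N, fun V _ H S μ T hμ hcov => ?_⟩
  set F := lowEdgeGraph H S (t + 1)
  obtain ⟨Y, hY, hYcard⟩ := exists_isVertexCover_card_eq F
  have hNY : N ≤ #Y := hYcard ▸ hcov
  have hYpos : (0 : ℝ) < #Y := by
    exact_mod_cast (Nat.zero_lt_of_lt (hlarge 0 (Nat.zero_le _)).lt).trans_le hNY
  obtain ⟨i, hi, E, hE, hadj, hYE, hEhubs⟩ :=
    Scale.exists_pairwiseDisjoint_edges hb hσ (hlarge _ le_rfl) T hY hYcard hNY
  obtain ⟨h, hh, hh', hweight⟩ := (hlarge i hi.le).exists_isProtectingWeight T hμ hY hNY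
  have hsize : (σ (8 * b)).size ≤ (σ i).size / 2 := (Scale.antitone_size hσ hi).trans (hσ i).size_le
  have hlast : (σ (8 * b)).size * #Y ≤ h := (mul_le_mul_of_nonneg_right hsize hYpos.le).trans hh
  have hdisj (e) (he : e ∈ E) : Disjoint {e.1, e.2} (S ∪ hubs H F h) := by
    refine disjoint_union_right.mpr ⟨?_, (hEhubs e he).1.mono_right (hubs_anti hlast)⟩
    simpa using And.intro (hadj e he).1 (hadj e he).2.1
  obtain ⟨D, hDE, hD, hDcard⟩ := (hσ i).exists_isScattered hb T (lowEdgeGraph_le H S _) hE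
    hadj hYpos (by exact_mod_cast hYE) hdisj (fun e he => (hEhubs e he).2)
    ((hubs_anti hh').trans subset_union_right)
  refine Scale.exists_isMatchingGadget T hweight hD (fun e he => ?_) hDcard
  exact (codegree_anti subset_union_left _ _).trans (Nat.lt_succ_iff.mp (hadj e (hDE he)).2.2.2)

theorem exists_gadgetBound {b : ℕ} (hb : 0 < b) (k t : ℕ) :
    ∀ η > 0, ∃ N, GadgetBound.{u} b k t η N := by
  induction t with
  | zero => exact fun η _ => ⟨1, gadgetBound_zero b k η⟩
  | succ t ih => exact fun η hη => exists_gadgetBound_succ hb ih hη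

theorem exists_isMatchingGadget_of_treewidth_le (w k : ℕ) :
    ∃ N : ℕ, ∀ (V : Type u) [Finite V] (H : SimpleGraph V), treewidth H ≤ w →
      N < H.vertexCoverNum → ∃ M : Set V, IsMatchingGadget H k M := by
  obtain ⟨N, hN⟩ := exists_gadgetBound.{u} w.succ_pos k (3 * (w + 1) + 1) 1 one_pos
  refine ⟨2 * N, fun V _ H hw hcov => ?_⟩
  have := Fintype.ofFinite V
  obtain ⟨T⟩ := nonempty_topSystem_of_treewidth_le hw
  refine hN V H ∅ 0 T (isProtectingWeight_empty H 1 N) ?_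
  have hlow := T.coverNum_le_two_mul_coverNum_lowEdgeGraph w.succ_pos
  rw [← natCast_coverNum] at hcov
  have hcov' : 2 * N < coverNum H := by exact_mod_cast hcov
  omega

end Scales

end MatchingGadget

theorem mainTheorem4 (𝓗 : Set FiniteGraph.{u})
    (hvc : ¬ IsBoundedOn (fun H => H.graph.vertexCoverNum) 𝓗)
    (htw : IsBoundedOn (fun H => treewidth H.graph) 𝓗) (k : ℕ) :
    ∃ H ∈ 𝓗, ∃ M : Set H.V, IsMatchingGadget H.graph k M := by
  obtain ⟨w, hw⟩ := htw
  obtain ⟨N, hN⟩ := exists_isMatchingGadget_of_treewidth_le.{u} w k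
  simp only [IsBoundedOn, not_exists, not_forall, not_le] at hvc
  obtain ⟨H, hH, hcov⟩ := hvc N
  exact ⟨H, hH, hN H.V H.graph (hw H hH) hcov⟩
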